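/- **Conventions.** All topological spaces are locally compact, Hausdorff and second countable, with their Borel structure. A topological groupoid $G$ with unit space $G^{(0)}$ has continuous structure maps and open range and source maps $r,s$. A left $G$-space $X$ has a continuous open surjective moment map $r_X:X\to G^{(0)}$ and a continuous action $(\gamma,x)\mapsto\gamma x$, defined for $s(\gamma)=r_X(x)$, with $r_X(\gamma x)=r(\gamma)$, $\gamma(\gamma'x)=(\gamma\gamma')x$ and $ux=x$ for units $u$; put $G\ltimes X=\{(\gamma,x)\in G\times X: s(\gamma)=r_X(x)\}$. A Haar system for $G$ is a family $\lambda=(\lambda^u)_{u\in G^{(0)}}$, where $\lambda^u$ is a Radon measure on $r^{-1}(u)$, such that $u\mapsto\int f\,d\lambda^u$ is continuous for every continuous compactly supported $f:G\to\mathbf C$, and $\gamma\lambda^{s(\gamma)}=\lambda^{r(\gamma)}$ for all $\gamma\in G$. For a positive Borel function $f$ on $G\ltimes X$ let $$\lambda_1^X(f)(x)=\int f(\gamma,\gamma^{-1}x)\,d\lambda^{r_X(x)}(\gamma),\qquad \lambda_2^X(f)(x)=\int f(\gamma^{-1},x)\,d\lambda^{r_X(x)}(\gamma).$$ For a measure $\nu$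 on $X$, $\nu\circ\lambda_i^X$ is the measure $f\mapsto\int\lambda_i^X(f)\,d\nu$ on $G\ltimes X$. The measure $\nu$ is *quasi-invariant* if $\nu\circ\lambda_1^X$ and $\nu\circ\lambda_2^X$ have the same null sets. For a Borel function $\Delta:G\ltimes X\to\mathbf R_+^*=(0,\infty)$, $\nu$ is a *$\Delta$-measure* if $\nu\circ\lambda_1^X=\Delta\,(\nu\circ\lambda_2^X)$. For a continuous map $\pi:X\to Y$, a *Borel $\pi$-system* is a family $\rho=(\rho_y)_{y\in Y}$, where $\rho_y$ is a $\sigma$-finite measure on $\pi^{-1}(y)$, such that $y\mapsto\int f\,d\rho_y$ is Borel for every positive Borel $f$ on $X$. For a measure $\mu$ on $Y$, $\mu\circ\rho=\int\rho_y\,d\mu(y)$ is the measure $f\mapsto\int\!\int f\,d\rho_y\,d\mu(y)$. A *disintegration of $\nu$ along $\pi$* is an equality $\nu=\int\rho_y\,d\mu(y)$ where $\rho$ is a Borel $\pi$-system and $\mu$ is a pseudo-image of $\nu$, i.e. $\mu(B)=0\iff\nu(\pi^{-1}(B))=0$ for Borel $B\subset Y$. **Proposition 3.1.** Let $(G,\lambda)$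 be a locally compact groupoid with Haar system, $X,Y$ left $G$-spaces, and $\pi:X\to Y$ a continuous $G$-equivariant surjection. Let $\nu$ and $\mu$ be $\sigma$-finite measures on $X$ and $Y$, and let $\rho_y$ be a measure on $\pi^{-1}(y)$ for each $y\in Y$. (i) Suppose that $\nu=\int\rho_y\,d\mu(y)$ is a disintegration of $\nu$ along $\pi$ and that $\nu$ is quasi-invariant. Then $\mu$ is quasi-invariant, and $\gamma\rho_y\sim\rho_{\gamma y}$ (same null sets) for $(\mu\circ\lambda_1^Y)$-a.e. $(\gamma,y)\in G\ltimes Y$. Moreover, for every Borel $\Delta_X:G\ltimes X\to\mathbf R_+^*$ such that $$\nu\circ\lambda_1^X=\Delta_X(\nu\circ\lambda_2^X)\tag{1}$$ there exist Borel functions $\Delta_Y:G\ltimes Y\to\mathbf R_+^*$ and $\delta:G\ltimes X\to\mathbf R_+^*$ such that $$\mu\circ\lambda_1^Y=\Delta_Y(\mu\circ\lambda_2^Y),\tag{2}$$ $$\gamma\rho_y=\delta(\gamma^{-1},\cdot)\,\rho_{\gamma y}\quad\text{for }(\mu\circ\lambda_1^Y)\text{-a.e. }(\gamma,y)\in G\ltimes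 Y,\tag{3}$$ $$\Delta_X(\gamma,x)=\delta(\gamma,x)\,\Delta_Y(\gamma,\pi(x))\quad\text{for }(\nu\circ\lambda_1^X)\text{-a.e. }(\gamma,x)\in G\ltimes X.\tag{4}$$ (ii) Conversely, suppose that $\rho$ is a Borel $\pi$-system with $\nu=\mu\circ\rho$ ($\mu$ need not be a pseudo-image of $\nu$), and that $\Delta_Y:G\ltimes Y\to\mathbf R_+^*$ and $\delta:G\ltimes X\to\mathbf R_+^*$ are Borel functions satisfying (2) and (3). Then $\nu$ is a $\Delta_X$-measure for every Borel function $\Delta_X:G\ltimes X\to\mathbf R_+^*$ satisfying (4), in particular for $\Delta_X(\gamma,x)=\delta(\gamma,x)\Delta_Y(\gamma,\pi(x))$. -/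

import Mathlib

open MeasureTheory Topology Set

/-- The fibre of `p` above `w`. -/
abbrev Fiber {Z W : Type*} (p : Z → W) (w : W) : Type _ := {z : Z // p z = w}

/-- A topological groupoid with space of arrows `G` and unit space `U` (identified with a subspace
of `G` through the continuous map `unit`, which has the continuous left inverse `r`).
The product `mul g h` is defined when `s g = r h`. The range and source maps are open. -/
structure TopGroupoid (G U : Type*) [TopologicalSpace G] [TopologicalSpace U] where
  r : G → U
  s : G → U
  unit : U → G
  inv : G → G
  mul : (g h : G) → s g = r h → G
  r_unit : ∀ u, r (unit u) = u
  s_unit : ∀ u, s (unit u) = u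
  r_inv : ∀ g, r (inv g) = s g
  s_inv : ∀ g, s (inv g) = r g
  r_mul : ∀ g h e, r (mul g h e) = r g
  s_mul : ∀ g h e, s (mul g h e) = s h
  unit_mul : ∀ g, mul (unit (r g)) g (s_unit (r g)) = g
  mul_unit : ∀ g, mul g (unit (s g)) (r_unit (s g)).symm = g
  inv_mul : ∀ g, mul (inv g) g (s_inv g) = unit (s g)
  mul_inv : ∀ g, mul g (inv g) (r_inv g).symm = unit (r g)
  mul_assoc : ∀ g h k (e₁ : s g = r h) (e₂ : s h = r k),
    mul (mul g h e₁) k ((s_mul g h e₁).trans e₂) = mul g (mul h k e₂) (e₁.trans (r_mul h k e₂).symm)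
  continuous_r : Continuous r
  continuous_s : Continuous s
  continuous_unit : Continuous unit
  continuous_inv : Continuous inv
  continuous_mul : Continuous fun p : {p : G × G // s p.1 = r p.2} => mul p.1.1 p.1.2 p.2
  isOpenMap_r : IsOpenMap r
  isOpenMap_s : IsOpenMap s

/-- A (topological) left `𝒢`-space: a space fibred over the unit space by a continuous open
surjection `moment`, with a continuous action map `(g, x) ↦ g x` defined when `s g = moment x`. -/
structure LeftGSpace {G U : Type*} [TopologicalSpace G] [TopologicalSpace U]
    (𝒢 : TopGroupoid G U) (X : Type*) [TopologicalSpace X] where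
  moment : X → U
  act : (g : G) → (x : X) → 𝒢.s g = moment x → X
  moment_act : ∀ g x e, moment (act g x e) = 𝒢.r g
  unit_act : ∀ x, act (𝒢.unit (moment x)) x (𝒢.s_unit (moment x)) = x
  mul_act : ∀ g h x (e₁ : 𝒢.s g = 𝒢.r h) (e₂ : 𝒢.s h = moment x),
    act (𝒢.mul g h e₁) x ((𝒢.s_mul g h e₁).trans e₂) =
      act g (act h x e₂) (e₁.trans (moment_act h x e₂).symm)
  surjective_moment : Function.Surjective moment
  continuous_moment : Continuous moment
  isOpenMap_moment : IsOpenMap moment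
  continuous_act : Continuous fun p : {p : G × X // 𝒢.s p.1 = moment p.2} => act p.1.1 p.1.2 p.2

/-- A continuous `p`-system of measures: `α w` is a Radon measure on the fibre of `p` above `w` and
`w ↦ ∫ f dα_w` is continuous for every continuous function `f` with compact support.
(On second countable locally compact Hausdorff spaces, Radon means finite on compact sets.) -/
structure IsContinuousSystem {Z W : Type*} [TopologicalSpace Z] [MeasurableSpace Z]
    [TopologicalSpace W] (p : Z → W) (α : (w : W) → Measure (Fiber p w)) : Prop where
  finite_on_compacts : ∀ w, IsFiniteMeasureOnCompacts (α w)
  continuous_integral : ∀ f : Z → ℂ, Continuous f → HasCompactSupport f →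
    Continuous fun w => ∫ z, f z.1 ∂(α w)

/-- A Borel `p`-system of measures: `α w` is a σ-finite measure on the fibre of `p` above `w` and
`w ↦ ∫ f dα_w` is Borel for every positive Borel function `f`. -/
structure IsBorelSystem {Z W : Type*} [MeasurableSpace Z] [MeasurableSpace W]
    (p : Z → W) (α : (w : W) → Measure (Fiber p w)) : Prop where
  sigmaFinite : ∀ w, SigmaFinite (α w)
  measurable_lintegral : ∀ f : Z → ENNReal, Measurable f →
    Measurable fun w => ∫⁻ z, f z.1 ∂(α w)

namespace TopGroupoid

variable {G U : Type*} [TopologicalSpace G] [TopologicalSpace U]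

/-- Left multiplication by `g`, as a map from the arrows with range `s g` to those with
range `r g`. -/
def leftMul (𝒢 : TopGroupoid G U) (g : G) (h : Fiber 𝒢.r (𝒢.s g)) : Fiber 𝒢.r (𝒢.r g) :=
  ⟨𝒢.mul g h.1 h.2.symm, 𝒢.r_mul _ _ _⟩

/-- A left Haar system: a continuous `r`-system of measures `(λ^u)` such that
`g λ^{s g} = λ^{r g}` for every arrow `g`. -/
structure IsHaarSystem [MeasurableSpace G] (𝒢 : TopGroupoid G U)
    (lam : (u : U) → Measure (Fiber 𝒢.r u)) : Prop where
  isContinuousSystem : IsContinuousSystem 𝒢.r lam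
  equivariant : ∀ g, (lam (𝒢.s g)).map (𝒢.leftMul g) = lam (𝒢.r g)

end TopGroupoid

namespace LeftGSpace

variable {G U X : Type*} [TopologicalSpace G] [TopologicalSpace U] [TopologicalSpace X]
  {𝒢 : TopGroupoid G U}

/-- The underlying space of the semi-direct product `G ⋉ X`: pairs `(g, x)` with `s g = moment x`.
It has the subspace topology and the Borel structure inherited from `G × X`. -/
abbrev SemiDirect (𝒳 : LeftGSpace 𝒢 X) : Type _ := {p : G × X // 𝒢.s p.1 = 𝒳.moment p.2}

/-- The range map `(g, x) ↦ g x` of `G ⋉ X`. -/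
def rng (𝒳 : LeftGSpace 𝒢 X) (p : 𝒳.SemiDirect) : X := 𝒳.act p.1.1 p.1.2 p.2

/-- For `g` with range `moment x`, the element `(g, g⁻¹ x)` of `G ⋉ X`; its range is `x`. -/
def toRangeFiber (𝒳 : LeftGSpace 𝒢 X) (x : X) (g : Fiber 𝒢.r (𝒳.moment x)) : 𝒳.SemiDirect :=
  ⟨(g.1, 𝒳.act (𝒢.inv g.1) x ((𝒢.s_inv g.1).trans g.2)),
    ((𝒳.moment_act _ _ _).trans (𝒢.r_inv g.1)).symm⟩

/-- For `g` with range `moment x`, the element `(g⁻¹, x)` of `G ⋉ X`; its source is `x`. -/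
def toSourceFiber (𝒳 : LeftGSpace 𝒢 X) (x : X) (g : Fiber 𝒢.r (𝒳.moment x)) : 𝒳.SemiDirect :=
  ⟨(𝒢.inv g.1, x), (𝒢.s_inv g.1).trans g.2⟩

variable [MeasurableSpace G] [MeasurableSpace X]

/-- The measure `λ₁(·)(x)` on `G ⋉ X`: `λ₁(f)(x) = ∫ f(g, g⁻¹ x) dλ^{r(x)}(g)`. -/
noncomputable def lam1 (𝒳 : LeftGSpace 𝒢 X) (lam : (u : U) → Measure (Fiber 𝒢.r u)) (x : X) :
    Measure 𝒳.SemiDirect :=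
  (lam (𝒳.moment x)).map (𝒳.toRangeFiber x)

/-- The measure `λ₂(·)(x)` on `G ⋉ X`: `λ₂(f)(x) = ∫ f(g⁻¹, x) dλ^{r(x)}(g)`. -/
noncomputable def lam2 (𝒳 : LeftGSpace 𝒢 X) (lam : (u : U) → Measure (Fiber 𝒢.r u)) (x : X) :
    Measure 𝒳.SemiDirect :=
  (lam (𝒳.moment x)).map (𝒳.toSourceFiber x)

/-- The measure `ν ∘ λ₁` on `G ⋉ X`. -/
noncomputable def compLam1 (𝒳 : LeftGSpace 𝒢 X) (lam : (u : U) → Measure (Fiber 𝒢.r u))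
    (ν : Measure X) : Measure 𝒳.SemiDirect :=
  ν.bind (𝒳.lam1 lam)

/-- The measure `ν ∘ λ₂` on `G ⋉ X`. -/
noncomputable def compLam2 (𝒳 : LeftGSpace 𝒢 X) (lam : (u : U) → Measure (Fiber 𝒢.r u))
    (ν : Measure X) : Measure 𝒳.SemiDirect :=
  ν.bind (𝒳.lam2 lam)

/-- `ν` is quasi-invariant: `ν ∘ λ₁` and `ν ∘ λ₂` have the same null sets. -/
def IsQuasiInvariant (𝒳 : LeftGSpace 𝒢 X) (lam : (u : U) → Measure (Fiber 𝒢.r u))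
    (ν : Measure X) : Prop :=
  𝒳.compLam1 lam ν ≪ 𝒳.compLam2 lam ν ∧ 𝒳.compLam2 lam ν ≪ 𝒳.compLam1 lam ν

/-- `ν` is a `Δ`-measure: `Δ` is a strictly positive Borel function on `G ⋉ X` with
`ν ∘ λ₁ = Δ (ν ∘ λ₂)`. -/
structure IsDeltaMeasure (𝒳 : LeftGSpace 𝒢 X) (lam : (u : U) → Measure (Fiber 𝒢.r u))
    (Δ : 𝒳.SemiDirect → ℝ) (ν : Measure X) : Prop where
  measurable : Measurable Δ
  pos : ∀ p, 0 < Δ p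
  eq_withDensity :
    𝒳.compLam1 lam ν = (𝒳.compLam2 lam ν).withDensity fun p => ENNReal.ofReal (Δ p)

end LeftGSpace

/-- `ν = μ ∘ ρ`, that is, `ν = ∫ ρ_y dμ(y)`: `∫ f dν = ∫ (∫ f dρ_y) dμ(y)` for every positive
Borel function `f`. -/
def IsIntegralOfSystem {X Y : Type*} [MeasurableSpace X] [MeasurableSpace Y] (π : X → Y)
    (ν : Measure X) (ρ : (y : Y) → Measure (Fiber π y)) (μ : Measure Y) : Prop :=
  ∀ f : X → ENNReal, Measurable f → ∫⁻ x, f x ∂ν = ∫⁻ y, ∫⁻ x, f x.1 ∂(ρ y) ∂μ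

/-- `ν = ∫ ρ_y dμ(y)` is a disintegration of `ν` along `π`: `ρ` is a Borel `π`-system of measures,
`ν = μ ∘ ρ`, and the base measure `μ` is a pseudo-image of `ν` under `π`, that is, a Borel set
`B` is `μ`-null if and only if its preimage under `π` is `ν`-null. -/
structure IsDisintegration {X Y : Type*} [MeasurableSpace X] [MeasurableSpace Y] (π : X → Y)
    (ν : Measure X) (ρ : (y : Y) → Measure (Fiber π y)) (μ : Measure Y) : Prop where
  isBorelSystem : IsBorelSystem π ρ
  isIntegral : IsIntegralOfSystem π ν ρ μ
  pseudoImage : ∀ B : Set Y, MeasurableSet B → (μ B = 0 ↔ ν (π ⁻¹' B) = 0)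

/-- `π` is `G`-equivariant: `π` commutes with the moment maps and `π (g x) = g π(x)`. -/
structure IsEquivariant {G U X Y : Type*} [TopologicalSpace G] [TopologicalSpace U]
    [TopologicalSpace X] [TopologicalSpace Y] {𝒢 : TopGroupoid G U}
    (𝒳 : LeftGSpace 𝒢 X) (𝒴 : LeftGSpace 𝒢 Y) (π : X → Y) : Prop where
  moment_map : ∀ x, 𝒴.moment (π x) = 𝒳.moment x
  map_act : ∀ g x (e : 𝒢.s g = 𝒳.moment x),
    π (𝒳.act g x e) = 𝒴.act g (π x) (e.trans (moment_map x).symm)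

namespace IsEquivariant

variable {G U X Y : Type*} [TopologicalSpace G] [TopologicalSpace U]
    [TopologicalSpace X] [TopologicalSpace Y] {𝒢 : TopGroupoid G U}
    {𝒳 : LeftGSpace 𝒢 X} {𝒴 : LeftGSpace 𝒢 Y} {π : X → Y}

/-- The map `id × π : G ⋉ X → G ⋉ Y`. -/
def idProd (hπ : IsEquivariant 𝒳 𝒴 π) (p : 𝒳.SemiDirect) : 𝒴.SemiDirect :=
  ⟨(p.1.1, π p.1.2), p.2.trans (hπ.moment_map p.1.2).symm⟩

/-- For `p = (g, y)`, the action `x ↦ g x` from the fibre of `π` above `y` to the fibre of `π`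
above `g y`. -/
def actFiber (hπ : IsEquivariant 𝒳 𝒴 π) (p : 𝒴.SemiDirect) (x : Fiber π p.1.2) :
    Fiber π (𝒴.rng p) :=
  ⟨𝒳.act p.1.1 x.1 (p.2.trans ((congrArg 𝒴.moment x.2).symm.trans (hπ.moment_map x.1))), by
    obtain ⟨⟨g, y⟩, e⟩ := p
    obtain ⟨x, hx⟩ := x
    dsimp only at hx
    subst hx
    exact hπ.map_act g x _⟩

/-- For `p = (g, y)` and `x` in the fibre of `π` above `g y`, the element `(g⁻¹, x)` of
`G ⋉ X`. -/
def invPair (hπ : IsEquivariant 𝒳 𝒴 π) (p : 𝒴.SemiDirect) (x : Fiber π (𝒴.rng p)) :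
    𝒳.SemiDirect :=
  ⟨(𝒢.inv p.1.1, x.1), by
    rw [𝒢.s_inv, ← hπ.moment_map, x.2]
    exact (𝒴.moment_act _ _ _).symm⟩

variable [MeasurableSpace X]

/-- For `p = (g, y)`, the measure `g ρ_y` on the fibre of `π` above `g y`. -/
noncomputable def translate (hπ : IsEquivariant 𝒳 𝒴 π) (ρ : (y : Y) → Measure (Fiber π y))
    (p : 𝒴.SemiDirect) : Measure (Fiber π (𝒴.rng p)) :=
  (ρ p.1.2).map (hπ.actFiber p)

/-- The relation `g ρ_y = δ(g⁻¹, ·) ρ_{g y}` at `p = (g, y)`. -/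
def TranslateEq (hπ : IsEquivariant 𝒳 𝒴 π) (ρ : (y : Y) → Measure (Fiber π y))
    (δ : 𝒳.SemiDirect → ℝ) (p : 𝒴.SemiDirect) : Prop :=
  hπ.translate ρ p = (ρ (𝒴.rng p)).withDensity fun x => ENNReal.ofReal (δ (hπ.invPair p x))

end IsEquivariant

/-! The families `λ₁`, `λ₂` are measurable in `x`, so that `ν ∘ λ₁` and `ν ∘ λ₂` are given by
the expected iterated integrals. -/

theorem IsContinuousSystem.measurable_map_coe {Z W T : Type*} [TopologicalSpace Z]
    [LocallyCompactSpace Z] [T2Space Z] [SecondCountableTopology Z] [MeasurableSpace Z]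
    [BorelSpace Z] [TopologicalSpace W] [T1Space W] [TopologicalSpace T] [MeasurableSpace T]
    [BorelSpace T] {p : Z → W} (hp : Continuous p) {α : (w : W) → Measure (Fiber p w)}
    (hα : IsContinuousSystem p α) {q : T → W} (hq : Continuous q) {V : Set Z} (hV : IsOpen V) :
    Measurable fun t => (α (q t)) (Subtype.val ⁻¹' V) := by
  have := hα.finite_on_compacts
  have hfib : ∀ w, IsClosed {z | p z = w} := fun w => isClosed_singleton.preimage hp
  have : LocallyCompactSpace V := hV.locallyCompactSpace
  have : SigmaCompactSpace V := inferInstance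
  let K : ℕ → Set Z := fun n => Subtype.val '' compactCovering V n
  have hKc : ∀ n, IsCompact (K n) := fun n =>
    (isCompact_compactCovering V n).image continuous_subtype_val
  have hKV : ∀ n, K n ⊆ V := by rintro n _ ⟨x, -, rfl⟩; exact x.2
  have hKm : Monotone K := fun m n h => image_mono (compactCovering_subset V h)
  have hKU : ⋃ n, K n = V := by
    rw [← image_iUnion, iUnion_compactCovering, image_univ, Subtype.range_coe]
  have hf : ∀ n, ∃ f : C(Z, ℝ), EqOn f 1 (K n) ∧ EqOn f 0 Vᶜ ∧ HasCompactSupport f ∧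
      ∀ x, f x ∈ Icc (0 : ℝ) 1 := fun n =>
    exists_continuous_one_zero_of_isCompact (hKc n) hV.isClosed_compl
      (disjoint_compl_right_iff_subset.2 (hKV n))
  choose f hf1 hf0 hfc hfI using hf
  have hint : ∀ n, Measurable fun t => ENNReal.ofReal (∫ z, f n z.1 ∂(α (q t))) := by
    intro n
    have h := hα.continuous_integral (fun z => (f n z : ℂ))
      (Complex.continuous_ofReal.comp (f n).continuous) ((hfc n).comp_left Complex.ofReal_zero)
    have h2 : Continuous fun w => ∫ z, f n z.1 ∂(α w) := by
      have := Complex.continuous_re.comp h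
      simpa [Function.comp_def, integral_complex_ofReal] using this
    exact ((h2.comp hq).measurable).ennreal_ofReal
  have key : (fun t => (α (q t)) (Subtype.val ⁻¹' V)) =
      fun t => ⨆ n, ENNReal.ofReal (∫ z, f n z.1 ∂(α (q t))) := by
    funext t
    have hi : ∀ n, ENNReal.ofReal (∫ z, f n z.1 ∂(α (q t))) =
        ∫⁻ z, ENNReal.ofReal (f n z.1) ∂(α (q t)) := by
      intro n
      refine ofReal_integral_eq_lintegral_ofReal ?_ (ae_of_all _ fun z => (hfI n z.1).1)
      refine Continuous.integrable_of_hasCompactSupport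
        ((f n).continuous.comp continuous_subtype_val) ?_
      exact (hfc n).comp_isClosedEmbedding (hfib _).isClosedEmbedding_subtypeVal
    simp_rw [hi]
    apply le_antisymm
    · rw [← hKU, preimage_iUnion, Monotone.measure_iUnion (fun m n h => preimage_mono (hKm h))]
      refine iSup_mono fun n => ?_
      rw [← lintegral_indicator_one
        ((hKc n).isClosed.preimage continuous_subtype_val).measurableSet]
      refine lintegral_mono fun z => ?_
      by_cases hz : z ∈ Subtype.val ⁻¹' K n
      · have := hf1 n hz
        simp [indicator_of_mem hz, this]
      · simp [indicator_of_notMem hz]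
    · refine iSup_le fun n => ?_
      rw [← lintegral_indicator_one (hV.preimage continuous_subtype_val).measurableSet]
      refine lintegral_mono fun z => ?_
      by_cases hz : z ∈ Subtype.val ⁻¹' V
      · simp only [indicator_of_mem hz, Pi.one_apply]
        exact ENNReal.ofReal_le_one.2 (hfI n z.1).2
      · have := hf0 n hz
        simp [indicator_of_notMem hz, this]
  rw [key]
  exact Measurable.iSup hint

theorem IsContinuousSystem.measurable_section {Z W T : Type*} [TopologicalSpace Z]
    [LocallyCompactSpace Z] [T2Space Z] [SecondCountableTopology Z] [MeasurableSpace Z]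
    [BorelSpace Z] [TopologicalSpace W] [T1Space W] [TopologicalSpace T] [MeasurableSpace T]
    [BorelSpace T] {p : Z → W} (hp : Continuous p) {α : (w : W) → Measure (Fiber p w)}
    (hα : IsContinuousSystem p α) {q : T → W} (hq : Continuous q)
    {S : Set (Z × T)} (hS : MeasurableSet S) :
    Measurable fun t => (α (q t)) {z | (z.1, t) ∈ S} := by
  have := hα.finite_on_compacts
  have hfib : ∀ w, IsClosed {z | p z = w} := fun w => isClosed_singleton.preimage hp
  let V : ℕ → Set Z := fun n => interior ((CompactExhaustion.choice Z) n)
  have hVo : ∀ n, IsOpen (V n) := fun n => isOpen_interior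
  have hVm : Monotone V := fun m n h =>
    interior_mono ((CompactExhaustion.choice Z).subset h)
  have hVU : ⋃ n, V n = univ := by
    refine eq_univ_of_forall fun z => ?_
    obtain ⟨n, hn⟩ := (CompactExhaustion.choice Z).exists_mem z
    exact mem_iUnion.2 ⟨n + 1, (CompactExhaustion.choice Z).subset_interior_succ n hn⟩
  have hVfin : ∀ n w, (α w) (Subtype.val ⁻¹' V n) < ⊤ := by
    intro n w
    refine (measure_mono (preimage_mono interior_subset)).trans_lt
      (IsCompact.measure_lt_top (μ := α w) ?_)
    exact (hfib w).isClosedEmbedding_subtypeVal.isCompact_preimage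
      ((CompactExhaustion.choice Z).isCompact n)
  -- the restrictions to `V n`, pushed to `Z`
  let κ : ℕ → T → Measure Z := fun n t => ((α (q t)).map Subtype.val).restrict (V n)
  have hκa : ∀ n t B, MeasurableSet B → κ n t B = (α (q t)) (Subtype.val ⁻¹' (B ∩ V n)) := by
    intro n t B hB
    rw [Measure.restrict_apply hB, Measure.map_apply measurable_subtype_coe
      (hB.inter (hVo n).measurableSet)]
  have : ∀ n t, IsFiniteMeasure (κ n t) := fun n t => ⟨by
    rw [hκa n t _ MeasurableSet.univ, univ_inter]; exact hVfin n _⟩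
  have hκ : ∀ n, Measurable (κ n) := by
    intro n
    refine Measurable.measure_of_isPiSystem (BorelSpace.measurable_eq.trans rfl)
      isPiSystem_isOpen ?_ ?_
    · intro B hB
      simp_rw [hκa n _ B (IsOpen.measurableSet hB)]
      exact hα.measurable_map_coe hp hq (IsOpen.inter hB (hVo n))
    · simp_rw [hκa n _ _ MeasurableSet.univ]
      exact hα.measurable_map_coe hp hq (isOpen_univ.inter (hVo n))
  have hM : ∀ n, Measurable fun t => (κ n t).map fun z => (z, t) := by
    intro n
    have hmap : ∀ t B, MeasurableSet B →
        (κ n t).map (fun z => (z, t)) B = κ n t {z | (z, t) ∈ B} := fun t B hB =>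
      Measure.map_apply measurable_prodMk_right hB
    have : ∀ t, IsFiniteMeasure ((κ n t).map fun z => (z, t)) := fun t => inferInstance
    refine Measurable.measure_of_isPiSystem generateFrom_prod.symm isPiSystem_prod ?_ ?_
    · rintro _ ⟨A, hA, B, hB, rfl⟩
      have : (fun t => (κ n t).map (fun z => (z, t)) (A ×ˢ B)) =
          B.indicator fun t => κ n t A := by
        funext t
        rw [hmap t _ (MeasurableSet.prod hA hB)]
        by_cases ht : t ∈ B <;> simp [ht]
      rw [this]
      exact ((Measure.measurable_coe hA).comp (hκ n)).indicator hB
    · simp_rw [hmap _ _ MeasurableSet.univ]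
      simpa [Function.comp_def] using (Measure.measurable_coe MeasurableSet.univ).comp (hκ n)
  have key : (fun t => (α (q t)) {z | (z.1, t) ∈ S}) =
      fun t => ⨆ n, ((κ n t).map fun z => (z, t)) S := by
    funext t
    have hSt : MeasurableSet {z | (z, t) ∈ S} := measurable_prodMk_right hS
    have : ∀ n, ((κ n t).map fun z => (z, t)) S =
        (α (q t)) (Subtype.val ⁻¹' ({z | (z, t) ∈ S} ∩ V n)) := fun n => by
      rw [Measure.map_apply measurable_prodMk_right hS]
      exact hκa n t _ hSt
    simp_rw [this]
    rw [← Monotone.measure_iUnion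
      (fun m n h => preimage_mono (inter_subset_inter_right _ (hVm h))), ← preimage_iUnion,
      ← inter_iUnion, hVU, inter_univ]
    rfl
  rw [key]
  exact Measurable.iSup fun n => (Measure.measurable_coe hS).comp (hM n)

section

variable {G U X : Type*} [TopologicalSpace G] [TopologicalSpace U] [TopologicalSpace X]
  {𝒢 : TopGroupoid G U} (𝒳 : LeftGSpace 𝒢 X)

theorem LeftGSpace.continuous_toRange :
    Continuous fun p : {p : G × X // 𝒢.r p.1 = 𝒳.moment p.2} =>
      𝒳.toRangeFiber p.1.2 ⟨p.1.1, p.2⟩ := by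
  have h1 : Continuous fun p : {p : G × X // 𝒢.r p.1 = 𝒳.moment p.2} =>
      (⟨(𝒢.inv p.1.1, p.1.2), (𝒢.s_inv p.1.1).trans p.2⟩ : 𝒳.SemiDirect) :=
    ((𝒢.continuous_inv.comp (continuous_fst.comp continuous_subtype_val)).prodMk
      (continuous_snd.comp continuous_subtype_val)).subtype_mk _
  exact ((continuous_fst.comp continuous_subtype_val).prodMk
    (𝒳.continuous_act.comp h1)).subtype_mk _

theorem LeftGSpace.continuous_toSource :
    Continuous fun p : {p : G × X // 𝒢.r p.1 = 𝒳.moment p.2} =>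
      𝒳.toSourceFiber p.1.2 ⟨p.1.1, p.2⟩ :=
  ((𝒢.continuous_inv.comp (continuous_fst.comp continuous_subtype_val)).prodMk
      (continuous_snd.comp continuous_subtype_val)).subtype_mk _

variable [LocallyCompactSpace G] [T2Space G] [SecondCountableTopology G] [T2Space U]
  [SecondCountableTopology X]
  [MeasurableSpace G] [BorelSpace G] [MeasurableSpace X] [BorelSpace X]
  {lam : (u : U) → Measure (Fiber 𝒢.r u)}

theorem LeftGSpace.measurable_map_fiber (hlam : 𝒢.IsHaarSystem lam)
    (Φ : (x : X) → Fiber 𝒢.r (𝒳.moment x) → 𝒳.SemiDirect)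
    (hΦ : Continuous fun p : {p : G × X // 𝒢.r p.1 = 𝒳.moment p.2} => Φ p.1.2 ⟨p.1.1, p.2⟩) :
    Measurable fun x => (lam (𝒳.moment x)).map (Φ x) := by
  have hΦx : ∀ x, Measurable (Φ x) := fun x =>
    (hΦ.comp ((continuous_subtype_val.prodMk continuous_const).subtype_mk
      fun g : Fiber 𝒢.r (𝒳.moment x) => g.2)).measurable
  refine Measure.measurable_of_measurable_coe _ fun B hB => ?_
  have hcl : MeasurableSet {p : G × X | 𝒢.r p.1 = 𝒳.moment p.2} :=
    (isClosed_eq (𝒢.continuous_r.comp continuous_fst)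
      (𝒳.continuous_moment.comp continuous_snd)).measurableSet
  have hS : MeasurableSet (Subtype.val '' ((fun p : {p : G × X // 𝒢.r p.1 = 𝒳.moment p.2} =>
      Φ p.1.2 ⟨p.1.1, p.2⟩) ⁻¹' B)) := hcl.subtype_image (hΦ.measurable hB)
  have := hlam.isContinuousSystem.measurable_section 𝒢.continuous_r 𝒳.continuous_moment hS
  convert this using 2 with x
  rw [Measure.map_apply (hΦx x) hB]
  congr 1
  ext g
  constructor
  · intro hg
    exact ⟨⟨(g.1, x), g.2⟩, hg, rfl⟩
  · rintro ⟨⟨⟨g', x'⟩, e⟩, hg, he⟩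
    obtain ⟨rfl, rfl⟩ := Prod.mk.inj he
    exact hg

/-- `x ↦ λ₁(·)(x)` is measurable. -/
theorem LeftGSpace.measurable_lam1 (hlam : 𝒢.IsHaarSystem lam) : Measurable (𝒳.lam1 lam) :=
  𝒳.measurable_map_fiber hlam _ 𝒳.continuous_toRange

/-- `x ↦ λ₂(·)(x)` is measurable. -/
theorem LeftGSpace.measurable_lam2 (hlam : 𝒢.IsHaarSystem lam) : Measurable (𝒳.lam2 lam) :=
  𝒳.measurable_map_fiber hlam _ 𝒳.continuous_toSource

/-- `∫ f d(ν ∘ λ₁) = ∫ (∫ f(g, g⁻¹ x) dλ^{r(x)}(g)) dν(x)`. -/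
theorem LeftGSpace.lintegral_compLam1 (hlam : 𝒢.IsHaarSystem lam) (ν : Measure X)
    {f : 𝒳.SemiDirect → ENNReal} (hf : Measurable f) :
    ∫⁻ p, f p ∂(𝒳.compLam1 lam ν) =
      ∫⁻ x, ∫⁻ g, f (𝒳.toRangeFiber x g) ∂(lam (𝒳.moment x)) ∂ν := by
  rw [compLam1, Measure.lintegral_bind (𝒳.measurable_lam1 hlam).aemeasurable hf.aemeasurable]
  refine lintegral_congr fun x => lintegral_map hf ?_
  exact (𝒳.continuous_toRange.comp ((continuous_subtype_val.prodMk continuous_const).subtype_mk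
      fun g : Fiber 𝒢.r (𝒳.moment x) => g.2)).measurable

/-- `∫ f d(ν ∘ λ₂) = ∫ (∫ f(g⁻¹, x) dλ^{r(x)}(g)) dν(x)`. -/
theorem LeftGSpace.lintegral_compLam2 (hlam : 𝒢.IsHaarSystem lam) (ν : Measure X)
    {f : 𝒳.SemiDirect → ENNReal} (hf : Measurable f) :
    ∫⁻ p, f p ∂(𝒳.compLam2 lam ν) =
      ∫⁻ x, ∫⁻ g, f (𝒳.toSourceFiber x g) ∂(lam (𝒳.moment x)) ∂ν := by
  rw [compLam2, Measure.lintegral_bind (𝒳.measurable_lam2 hlam).aemeasurable hf.aemeasurable]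
  refine lintegral_congr fun x => lintegral_map hf ?_
  exact (𝒳.continuous_toSource.comp ((continuous_subtype_val.prodMk continuous_const).subtype_mk
      fun g : Fiber 𝒢.r (𝒳.moment x) => g.2)).measurable

end

/-! The inversion `(g, x) ↦ (g⁻¹, g x)` of `G ⋉ X` exchanges `ν ∘ λ₁` and `ν ∘ λ₂`, so `Δ_X` is the
density of the inverted measure. By Tonelli, `ν ∘ λ₂` disintegrates along `id × π` over `μ ∘ λ₂`,
the fibre measure at `(g, y)` being the copy of `ρ_y` on `{g} × π⁻¹(y)` (`compLam2_eq_bind`).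
Inversion commutes with `id × π` and carries this copy to the copy of `g ρ_y` lying over `(g⁻¹, g
y)`.

Once `μ ∘ λ₁ = Δ_Y (μ ∘ λ₂)`, the measures `ν ∘ λ₁` and `δ (Δ_Y ∘ (id × π)) (ν ∘ λ₂)` are therefore
integrals over the same base `μ ∘ λ₁`, one of translated fibre measures, the other of fibre measures
weighted by `δ`. Uniqueness of disintegrations (`ae_eq_of_bind_eq`) makes equality of the integrals
equivalent to almost everywhere equality of the fibre measures. This is
`compLam1_eq_withDensity_iff`: one direction is the converse part; the other gives the direct part
with `δ = Δ_X / (Δ_Y ∘ (id × π))`.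

Such a `Δ_Y` exists by Radon–Nikodym once `μ` is quasi-invariant, which holds because a Borel set of
`G ⋉ Y` is null for `μ ∘ λᵢ` exactly when its preimage is null for `ν ∘ λᵢ`. -/

section Systems

/-! ### Integrals of measures along a map: uniqueness, σ-finiteness, densities. -/

variable {S T : Type*} [MeasurableSpace S] [MeasurableSpace T]

/-- Finite intersections of a countable generating sequence; the empty intersection supplies `univ`,
which is needed to compare total masses. -/
theorem exists_countable_generating_piSystem [MeasurableSpace.CountablyGenerated S] :
    ∃ C : Set (Set S), C.Countable ∧ IsPiSystem C ∧ univ ∈ C ∧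
      ‹MeasurableSpace S› = MeasurableSpace.generateFrom C := by
  let B := MeasurableSpace.natGeneratingSequence S
  have hB : ∀ F : Finset ℕ, MeasurableSet (⋂ i ∈ F, B i) := fun F =>
    Finset.measurableSet_biInter F fun i _ =>
      MeasurableSpace.measurableSet_natGeneratingSequence i
  refine ⟨range fun F : Finset ℕ => ⋂ i ∈ F, B i, countable_range _, ?_, ⟨∅, by simp⟩, ?_⟩
  · rintro _ ⟨F, rfl⟩ _ ⟨F', rfl⟩ -
    exact ⟨F ∪ F', by simp only [Finset.mem_union, iInter_or, iInter_inter_distrib]⟩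
  · apply le_antisymm
    · conv_lhs => rw [← MeasurableSpace.generateFrom_natGeneratingSequence S]
      refine MeasurableSpace.generateFrom_mono ?_
      rintro _ ⟨n, rfl⟩
      exact ⟨{n}, by simp [B]⟩
    · refine MeasurableSpace.generateFrom_le ?_
      rintro _ ⟨F, rfl⟩
      exact hB F

theorem measurable_withDensity_of_measurable {A : T → Measure S} (hA : Measurable A)
    {f : S → ENNReal} (hf : Measurable f) : Measurable fun p => (A p).withDensity f := by
  refine Measure.measurable_of_measurable_coe _ fun B hB => ?_
  simp_rw [withDensity_apply f hB, ← lintegral_indicator hB]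
  exact (Measure.measurable_lintegral (hf.indicator hB)).comp hA

theorem withDensity_injective {m m' : Measure S} {f : S → ENNReal} (hf : Measurable f)
    (h0 : ∀ x, f x ≠ 0) (htop : ∀ x, f x ≠ ⊤) (h : m.withDensity f = m'.withDensity f) :
    m = m' := by
  rw [← withDensity_inv_same (μ := m) hf (ae_of_all _ h0) (ae_of_all _ htop), h,
    withDensity_inv_same hf (ae_of_all _ h0) (ae_of_all _ htop)]

/-- Uniqueness of disintegrations: two families of measures on the fibres of `q` with the same
σ-finite integral coincide almost everywhere. -/
theorem ae_eq_of_bind_eq [MeasurableSpace.CountablyGenerated S] {q : S → T} (hq : Measurable q)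
    {M : Measure T} [SigmaFinite M] {A A' : T → Measure S} (hA : Measurable A)
    (hA' : Measurable A') (hAq : ∀ p, ∀ᵐ z ∂(A p), q z = p) (hAq' : ∀ p, ∀ᵐ z ∂(A' p), q z = p)
    [SigmaFinite (M.bind A)] (h : M.bind A = M.bind A') : ∀ᵐ p ∂M, A p = A' p := by
  -- Weighting by a positive `w` integrable for `M.bind A` makes almost every `A p` finite, so that
  -- a countable π-system determines it; the weight is removed at the end.
  obtain ⟨w, hw0, hwm, hw⟩ := exists_pos_lintegral_lt_of_sigmaFinite (M.bind A) one_ne_zero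
  have hwm' : Measurable fun z => (w z : ENNReal) := hwm.coe_nnreal_ennreal
  obtain ⟨C, hCc, hCp, hCu, hCg⟩ := exists_countable_generating_piSystem (S := S)
  have hCm : ∀ B ∈ C, MeasurableSet B := fun B hB => by
    rw [hCg]; exact MeasurableSpace.measurableSet_generateFrom hB
  -- Since `A p` lives on `q ⁻¹' {p}`, restricting the base to `D` is restricting the integral to `q
  -- ⁻¹' D`.
  have key : ∀ {A : T → Measure S}, Measurable A → (∀ p, ∀ᵐ z ∂(A p), q z = p) →
      ∀ B, MeasurableSet B → ∀ D, MeasurableSet D →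
      ∫⁻ p in D, (A p).withDensity (fun z => w z) B ∂M =
        ∫⁻ z in q ⁻¹' D ∩ B, w z ∂(M.bind A) := by
    intro A hA hAq B hB D hD
    have hDB := (hq hD).inter hB
    rw [← lintegral_indicator hDB, Measure.lintegral_bind hA.aemeasurable
      (hwm'.indicator hDB).aemeasurable, ← lintegral_indicator hD]
    refine lintegral_congr fun p => ?_
    by_cases hp : p ∈ D
    · rw [indicator_of_mem hp, withDensity_apply _ hB, ← lintegral_indicator hB]
      refine lintegral_congr_ae ?_
      filter_upwards [hAq p] with z hz
      have hz' : z ∈ q ⁻¹' D := by rw [mem_preimage, hz]; exact hp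
      rw [← indicator_indicator, indicator_of_mem hz']
    · rw [indicator_of_notMem hp]
      symm
      rw [lintegral_eq_zero_iff (hwm'.indicator hDB)]
      filter_upwards [hAq p] with z hz
      refine indicator_of_notMem (fun hz' => hp ?_) _
      rw [← hz]; exact hz'.1
  have hAm := measurable_withDensity_of_measurable hA hwm'
  have hAm' := measurable_withDensity_of_measurable hA' hwm'
  have hC : ∀ᵐ p ∂M, ∀ B ∈ C, (A p).withDensity (fun z => w z) B =
      (A' p).withDensity (fun z => w z) B := by
    refine (ae_ball_iff hCc).2 fun B hB => ?_
    refine ae_eq_of_forall_setLIntegral_eq_of_sigmaFinite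
      ((Measure.measurable_coe (hCm B hB)).comp hAm)
      ((Measure.measurable_coe (hCm B hB)).comp hAm') fun D hD _ => ?_
    change ∫⁻ p in D, (A p).withDensity (fun z => w z) B ∂M =
      ∫⁻ p in D, (A' p).withDensity (fun z => w z) B ∂M
    rw [key hA hAq B (hCm B hB) D hD, key hA' hAq' B (hCm B hB) D hD, h]
  have hfin : ∀ᵐ p ∂M, ∫⁻ z, w z ∂(A p) < ⊤ := by
    refine ae_lt_top ((Measure.measurable_lintegral hwm').comp hA) ?_
    rw [← Measure.lintegral_bind hA.aemeasurable hwm'.aemeasurable]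
    exact (hw.trans ENNReal.one_lt_top).ne
  filter_upwards [hC, hfin] with p hp hpf
  have : IsFiniteMeasure ((A p).withDensity fun z => w z) := isFiniteMeasure_withDensity hpf.ne
  exact withDensity_injective hwm' (fun z => by simpa using (hw0 z).ne') (fun z => by simp)
    (ext_of_generate_finite C hCg hCp hp (hp univ hCu))

/-- Each `B n` is cut by the preimages of the spanning sets of `M` intersected with `{p | A p (B n)
≤ k}`; such a piece has mass at most `k` times that of the spanning set. -/
theorem sigmaFinite_bind_of_cover {q : S → T} (hq : Measurable q) {M : Measure T} [SigmaFinite M]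
    {A : T → Measure S} (hA : Measurable A) (hAq : ∀ p, ∀ᵐ z ∂(A p), q z = p)
    {B : ℕ → Set S} (hB : ∀ n, MeasurableSet (B n)) (hBU : ⋃ n, B n = univ)
    (hfin : ∀ p n, A p (B n) < ⊤) : SigmaFinite (M.bind A) := by
  have hAB : ∀ n, Measurable fun p => A p (B n) := fun n => (Measure.measurable_coe (hB n)).comp hA
  let D : ℕ × ℕ × ℕ → Set T := fun i => spanningSets M i.2.1 ∩ {p | A p (B i.1) ≤ i.2.2}
  have hD : ∀ i, MeasurableSet (D i) := fun i =>
    (measurableSet_spanningSets M _).inter (hAB i.1 measurableSet_Iic)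
  let E : ℕ × ℕ × ℕ → Set S := fun i => B i.1 ∩ q ⁻¹' D i
  refine Measure.sigmaFinite_of_countable (S := range E) (countable_range E) ?_ ?_
  · rintro _ ⟨i, rfl⟩
    rw [Measure.bind_apply ((hB _).inter (hq (hD i))) hA.aemeasurable]
    calc ∫⁻ p, A p (E i) ∂M
      _ ≤ ∫⁻ p, (spanningSets M i.2.1).indicator (fun _ => (i.2.2 : ENNReal)) p ∂M := by
          refine lintegral_mono fun p => ?_
          by_cases hp : p ∈ D i
          · rw [indicator_of_mem hp.1]
            exact (measure_mono inter_subset_left).trans hp.2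
          · refine le_trans (le_of_eq ?_) zero_le
            refine measure_mono_null (fun z hz => ?_) (hAq p)
            intro hz'
            exact hp (hz' ▸ hz.2)
      _ = i.2.2 * M (spanningSets M i.2.1) :=
          lintegral_indicator_const (measurableSet_spanningSets M _) _
      _ < ⊤ := ENNReal.mul_lt_top (ENNReal.natCast_lt_top _) (measure_spanningSets_lt_top M _)
  · refine eq_univ_of_forall fun z => ?_
    obtain ⟨n, hn⟩ := mem_iUnion.1 (hBU.ge (mem_univ z))
    obtain ⟨m, hm⟩ := mem_iUnion.1 ((iUnion_spanningSets M).ge (mem_univ (q z)))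
    obtain ⟨k, hk⟩ := ENNReal.exists_nat_gt (hfin (q z) n).ne
    exact mem_sUnion.2 ⟨_, ⟨(n, m, k), rfl⟩, hn, hm, hk.le⟩

theorem exists_density_of_absolutelyContinuous {M M' : Measure T} [SigmaFinite M] [SigmaFinite M']
    (h : M ≪ M') (h' : M' ≪ M) : ∃ Δ : T → ℝ, Measurable Δ ∧ (∀ p, 0 < Δ p) ∧
      M = M'.withDensity fun p => ENNReal.ofReal (Δ p) := by
  have hm := Measure.measurable_rnDeriv M M'
  -- The derivative is positive and finite only almost everywhere; the value `1` elsewhere makes `Δ`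
  -- positive at every point.
  let Δ : T → ℝ := fun p => if 0 < (M.rnDeriv M' p).toReal then (M.rnDeriv M' p).toReal else 1
  refine ⟨Δ, ?_, ?_, ?_⟩
  · exact Measurable.ite (hm.ennreal_toReal measurableSet_Ioi) hm.ennreal_toReal measurable_const
  · intro p
    by_cases hp : 0 < (M.rnDeriv M' p).toReal <;> simp [Δ, hp]
  · conv_lhs => rw [← Measure.withDensity_rnDeriv_eq M M' h]
    refine withDensity_congr_ae ?_
    filter_upwards [h' (Measure.rnDeriv_pos h), Measure.rnDeriv_lt_top M M'] with p h0 h1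
    have : 0 < (M.rnDeriv M' p).toReal := ENNReal.toReal_pos h0.ne' h1.ne
    simp only [Δ, if_pos this]
    exact (ENNReal.ofReal_toReal h1.ne).symm

theorem map_withDensity_comp {f : S → T} (hf : Measurable f) (m : Measure S) {g : T → ENNReal}
    (hg : Measurable g) : (m.withDensity (g ∘ f)).map f = (m.map f).withDensity g := by
  ext B hB
  rw [Measure.map_apply hf hB, withDensity_apply _ (hf hB), withDensity_apply _ hB,
    setLIntegral_map hB hg hf]
  rfl

theorem absolutelyContinuous_withDensity_of_pos {M : Measure T} {Δ : T → ℝ} (hΔ : Measurable Δ)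
    (h0 : ∀ p, 0 < Δ p) : M ≪ M.withDensity fun p => ENNReal.ofReal (Δ p) :=
  withDensity_absolutelyContinuous' hΔ.ennreal_ofReal.aemeasurable
    (ae_of_all _ fun p => by simpa using h0 p)

theorem bind_map {M : Measure T} {A : T → Measure S} (hA : Measurable A) {S' : Type*}
    [MeasurableSpace S'] {f : S → S'} (hf : Measurable f) :
    (M.bind A).map f = M.bind fun p => (A p).map f := by
  ext B hB
  rw [Measure.map_apply hf hB, Measure.bind_apply (hf hB) hA.aemeasurable,
    Measure.bind_apply hB (f := fun p => (A p).map f)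
      ((Measure.measurable_map f hf).comp hA).aemeasurable]
  exact lintegral_congr fun p => (Measure.map_apply hf hB).symm

/-- The factor `g ∘ q` is almost everywhere constant for each `A p`, so it moves to the base
measure. -/
theorem bind_withDensity {q : S → T} (hq : Measurable q) {M : Measure T} {A : T → Measure S}
    (hA : Measurable A) (hAq : ∀ p, ∀ᵐ z ∂(A p), q z = p) {f : S → ENNReal} (hf : Measurable f)
    {g : T → ENNReal} (hg : Measurable g) :
    (M.bind A).withDensity (fun z => f z * g (q z)) =
      (M.withDensity g).bind fun p => (A p).withDensity f := by
  have hAf := measurable_withDensity_of_measurable hA hf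
  have hfg : Measurable fun z => f z * g (q z) := hf.mul (hg.comp hq)
  ext B hB
  rw [withDensity_apply _ hB, Measure.bind_apply hB hAf.aemeasurable, ← lintegral_indicator hB,
    Measure.lintegral_bind hA.aemeasurable (hfg.indicator hB).aemeasurable,
    lintegral_withDensity_eq_lintegral_mul (g := fun p => (A p).withDensity f B) _ hg
      ((Measure.measurable_coe hB).comp hAf)]
  refine lintegral_congr fun p => ?_
  simp only [Pi.mul_apply]
  rw [withDensity_apply _ hB, ← lintegral_indicator hB, ← lintegral_const_mul _ (hf.indicator hB)]
  refine lintegral_congr_ae ?_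
  filter_upwards [hAq p] with z hz
  by_cases hzB : z ∈ B <;> simp [hzB, hz, mul_comm]

/-- Let `J` act compatibly on `S` and `T`. If `M.map J = Δ M`, a density `δ · (Δ ∘ q)` for
`(M.bind A).map J` with respect to `M.bind A` amounts to a density `δ` for the translates of
the measures `A p`. -/
theorem map_bind_eq_withDensity_iff [MeasurableSpace.CountablyGenerated S]
    [MeasurableSingletonClass T] {q : S → T} (hq : Measurable q) {JS : S → S} {JT : T → T}
    (hJS : Measurable JS) (hJT : Measurable JT)
    (hJTJT : Function.Involutive JT) (hqJ : ∀ z, q (JS z) = JT (q z))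
    {M : Measure T} {A : T → Measure S} (hA : Measurable A) (hAq : ∀ p, ∀ᵐ z ∂(A p), q z = p)
    [SigmaFinite (M.map JT)] [SigmaFinite ((M.bind A).map JS)]
    {Δ : T → ℝ} (hΔ : Measurable Δ) (hΔ0 : ∀ p, 0 < Δ p)
    (hM : M.map JT = M.withDensity fun p => ENNReal.ofReal (Δ p))
    {δ : S → ℝ} (hδ : Measurable δ) (hδ0 : ∀ z, 0 < δ z) :
    (M.bind A).map JS = (M.bind A).withDensity (fun z => ENNReal.ofReal (δ z * Δ (q z))) ↔
      ∀ᵐ p ∂(M.map JT),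
        (A p).map JS = (A (JT p)).withDensity fun z => ENNReal.ofReal (δ z) := by
  have hAJ : Measurable fun p => (A p).map JS := (Measure.measurable_map JS hJS).comp hA
  have hAδ := measurable_withDensity_of_measurable hA hδ.ennreal_ofReal
  -- Reindexing by `JT` puts each translated measure over the point where it lives; `h1` and `h2`
  -- then have the common base `M.map JT`.
  have h1 : (M.bind A).map JS = (M.map JT).bind fun p => (A (JT p)).map JS := by
    rw [bind_map hA hJS]
    ext B hB
    rw [Measure.bind_apply hB hAJ.aemeasurable,
      Measure.bind_apply hB (f := fun p => (A (JT p)).map JS) (hAJ.comp hJT).aemeasurable,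
      lintegral_map (f := fun p => (A (JT p)).map JS B) ((Measure.measurable_coe hB).comp (hAJ.comp hJT)) hJT]
    simp only [hJTJT _]
  have h2 : (M.bind A).withDensity (fun z => ENNReal.ofReal (δ z * Δ (q z))) =
      (M.map JT).bind fun p => (A p).withDensity fun z => ENNReal.ofReal (δ z) := by
    rw [hM, ← bind_withDensity hq hA hAq hδ.ennreal_ofReal hΔ.ennreal_ofReal]
    congr 1
    funext z
    exact ENNReal.ofReal_mul (hδ0 z).le
  -- The image of `M.map JT` under `JT` is `M`, and `M ≪ Δ M = M.map JT`; so `p` and `JT p` may be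
  -- exchanged in almost everywhere statements.
  have hqm : Measure.QuasiMeasurePreserving JT (M.map JT) (M.map JT) := by
    refine ⟨hJT, ?_⟩
    rw [Measure.map_map hJT hJT, hJTJT.comp_self, Measure.map_id, hM]
    exact absolutelyContinuous_withDensity_of_pos hΔ hΔ0
  have h3 : (∀ᵐ p ∂(M.map JT),
      (A (JT p)).map JS = (A p).withDensity fun z => ENNReal.ofReal (δ z)) ↔
      ∀ᵐ p ∂(M.map JT),
        (A p).map JS = (A (JT p)).withDensity fun z => ENNReal.ofReal (δ z) := by
    constructor <;> intro h <;> filter_upwards [hqm.ae h] with p hp <;>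
      simpa only [hJTJT p] using hp
  rw [← h3]
  constructor
  · intro h
    have : SigmaFinite ((M.map JT).bind fun p => (A (JT p)).map JS) := by rwa [← h1]
    refine ae_eq_of_bind_eq hq (hAJ.comp hJT) hAδ (fun p => ?_) (fun p => ?_)
      (h1.symm.trans (h.trans h2))
    · refine (ae_map_iff hJS.aemeasurable (hq (measurableSet_singleton p))).2 ?_
      filter_upwards [hAq (JT p)] with z hz
      rw [hqJ, hz, hJTJT]
      rfl
    · exact (withDensity_absolutelyContinuous _ _).ae_le (hAq p)
  · intro h
    rw [h1, h2]
    exact Measure.bind_congr_right h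

end Systems

/-! ### Inversion in `G ⋉ X` and the measures `ν ∘ λ₁`, `ν ∘ λ₂`. -/

namespace TopGroupoid

variable {G U : Type*} [TopologicalSpace G] [TopologicalSpace U] (𝒢 : TopGroupoid G U)

theorem mul_eq_of_eq_left {g g' h : G} (e : g = g') (e₁ : 𝒢.s g = 𝒢.r h) (e₂ : 𝒢.s g' = 𝒢.r h) :
    𝒢.mul g h e₁ = 𝒢.mul g' h e₂ := by subst e; rfl

theorem mul_eq_of_eq_right {g h h' : G} (e : h = h') (e₁ : 𝒢.s g = 𝒢.r h) (e₂ : 𝒢.s g = 𝒢.r h') :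
    𝒢.mul g h e₁ = 𝒢.mul g h' e₂ := by subst e; rfl

theorem inv_inv (g : G) : 𝒢.inv (𝒢.inv g) = g := by
  have e₁ : 𝒢.s (𝒢.inv (𝒢.inv g)) = 𝒢.r (𝒢.inv g) := 𝒢.s_inv _
  have e₂ : 𝒢.s (𝒢.inv g) = 𝒢.r g := 𝒢.s_inv _
  -- The product `(g⁻¹)⁻¹ g⁻¹ g` is `g` when bracketed on the left and `(g⁻¹)⁻¹` when bracketed on
  -- the right.
  have h := 𝒢.mul_assoc _ _ _ e₁ e₂
  have hu : 𝒢.unit (𝒢.s (𝒢.inv g)) = 𝒢.unit (𝒢.r g) := by rw [e₂]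
  have hu' : 𝒢.unit (𝒢.s g) = 𝒢.unit (𝒢.s (𝒢.inv (𝒢.inv g))) := by rw [𝒢.s_inv, 𝒢.r_inv]
  have hl := 𝒢.mul_eq_of_eq_left ((𝒢.inv_mul (𝒢.inv g)).trans hu)
    ((𝒢.s_mul _ _ e₁).trans e₂) (𝒢.s_unit (𝒢.r g))
  have hr := 𝒢.mul_eq_of_eq_right (g := 𝒢.inv (𝒢.inv g)) ((𝒢.inv_mul g).trans hu')
    (e₁.trans (𝒢.r_mul _ _ e₂).symm) (𝒢.r_unit _).symm
  rw [hl, hr, 𝒢.unit_mul, 𝒢.mul_unit] at h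
  exact h.symm

end TopGroupoid

namespace LeftGSpace

variable {G U X : Type*} [TopologicalSpace G] [TopologicalSpace U] [TopologicalSpace X]
  {𝒢 : TopGroupoid G U} (𝒳 : LeftGSpace 𝒢 X)

theorem act_congr {g g' : G} {x x' : X} (hg : g = g') (hx : x = x') (e : 𝒢.s g = 𝒳.moment x)
    (e' : 𝒢.s g' = 𝒳.moment x') : 𝒳.act g x e = 𝒳.act g' x' e' := by
  subst hg hx; rfl

theorem act_inv_act (g : G) (x : X) (e : 𝒢.s g = 𝒳.moment x)
    (e' : 𝒢.s (𝒢.inv g) = 𝒳.moment (𝒳.act g x e)) : 𝒳.act (𝒢.inv g) (𝒳.act g x e) e' = x := by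
  have h := 𝒳.mul_act (𝒢.inv g) g x (𝒢.s_inv g) e
  rw [← h, 𝒳.act_congr ((𝒢.inv_mul g).trans (congrArg 𝒢.unit e)) rfl _ (𝒢.s_unit _), 𝒳.unit_act]

/-- The inverse map `(g, x) ↦ (g⁻¹, g x)` of `G ⋉ X`. -/
def invol (p : 𝒳.SemiDirect) : 𝒳.SemiDirect :=
  ⟨(𝒢.inv p.1.1, 𝒳.rng p), (𝒢.s_inv _).trans (𝒳.moment_act _ _ _).symm⟩

theorem invol_invol : Function.Involutive 𝒳.invol := fun _ =>
  Subtype.ext (Prod.ext (𝒢.inv_inv _) (𝒳.act_inv_act _ _ _ _))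

theorem invol_toSourceFiber (x : X) (g : Fiber 𝒢.r (𝒳.moment x)) :
    𝒳.invol (𝒳.toSourceFiber x g) = 𝒳.toRangeFiber x g :=
  Subtype.ext (Prod.ext (𝒢.inv_inv _) rfl)

theorem continuous_invol : Continuous 𝒳.invol :=
  ((𝒢.continuous_inv.comp (continuous_fst.comp continuous_subtype_val)).prodMk
    𝒳.continuous_act).subtype_mk _

theorem continuous_toSourceFiber (x : X) : Continuous (𝒳.toSourceFiber x) :=
  ((𝒢.continuous_inv.comp continuous_subtype_val).prodMk continuous_const).subtype_mk _

section

variable [MeasurableSpace G] [MeasurableSpace X] {lam : (u : U) → Measure (Fiber 𝒢.r u)}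

theorem measurable_source : Measurable fun p : 𝒳.SemiDirect => p.1.2 :=
  measurable_snd.comp measurable_subtype_coe

theorem IsDeltaMeasure.isQuasiInvariant {𝒳 : LeftGSpace 𝒢 X} {ν : Measure X}
    {Δ : 𝒳.SemiDirect → ℝ} (h : 𝒳.IsDeltaMeasure lam Δ ν) : 𝒳.IsQuasiInvariant lam ν := by
  rw [IsQuasiInvariant, h.eq_withDensity]
  exact ⟨withDensity_absolutelyContinuous _ _,
    absolutelyContinuous_withDensity_of_pos h.measurable h.pos⟩

variable [BorelSpace G] [BorelSpace X] [SecondCountableTopology X]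

theorem lam1_eq_map (x : X) : 𝒳.lam1 lam x = (𝒳.lam2 lam x).map 𝒳.invol := by
  rw [lam1, lam2, Measure.map_map 𝒳.continuous_invol.measurable
    (𝒳.continuous_toSourceFiber x).measurable]
  congr 1
  funext g
  exact (𝒳.invol_toSourceFiber x g).symm

theorem ae_lam2_source [T1Space X] (x : X) : ∀ᵐ p ∂(𝒳.lam2 lam x), p.1.2 = x := by
  refine (ae_map_iff (𝒳.continuous_toSourceFiber x).measurable.aemeasurable
    (𝒳.measurable_source (measurableSet_singleton x))).2 (ae_of_all _ fun g => rfl)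

variable [LocallyCompactSpace G] [T2Space G] [SecondCountableTopology G] [T2Space U]

theorem compLam1_eq_map (hlam : 𝒢.IsHaarSystem lam) (ν : Measure X) :
    𝒳.compLam1 lam ν = (𝒳.compLam2 lam ν).map 𝒳.invol := by
  rw [compLam1, compLam2, bind_map (𝒳.measurable_lam2 hlam) 𝒳.continuous_invol.measurable]
  congr 1
  funext x
  exact 𝒳.lam1_eq_map x

theorem compLam2_eq_map (hlam : 𝒢.IsHaarSystem lam) (ν : Measure X) :
    𝒳.compLam2 lam ν = (𝒳.compLam1 lam ν).map 𝒳.invol := by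
  rw [𝒳.compLam1_eq_map hlam, Measure.map_map 𝒳.continuous_invol.measurable
    𝒳.continuous_invol.measurable, 𝒳.invol_invol.comp_self, Measure.map_id]

theorem ae_compLam2_source (hlam : 𝒢.IsHaarSystem lam) (ν : Measure X) {P : X → Prop}
    (hP : ∀ᵐ x ∂ν, P x) [T1Space X] : ∀ᵐ p ∂(𝒳.compLam2 lam ν), P p.1.2 := by
  obtain ⟨N, hPN, hNm, hN⟩ := exists_measurable_superset_of_null (ae_iff.1 hP)
  suffices h : 𝒳.compLam2 lam ν ((fun p => p.1.2) ⁻¹' N) = 0 from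
    measure_mono_null (fun p hp => hPN hp) h
  rw [compLam2, Measure.bind_apply (𝒳.measurable_source hNm) (𝒳.measurable_lam2 hlam).aemeasurable]
  refine (lintegral_congr_ae ?_).trans lintegral_zero
  filter_upwards [measure_eq_zero_iff_ae_notMem.1 hN] with x hx
  rw [measure_eq_zero_iff_ae_notMem]
  filter_upwards [𝒳.ae_lam2_source x] with p hp h
  exact hx (hp ▸ h)

/-- The range of an element is the source of its inverse, so this is the statement for `λ₂`
transported by inversion. -/
theorem ae_compLam1_rng (hlam : 𝒢.IsHaarSystem lam) (ν : Measure X) {P : X → Prop}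
    (hP : ∀ᵐ x ∂ν, P x) [T1Space X] : ∀ᵐ p ∂(𝒳.compLam1 lam ν), P (𝒳.rng p) := by
  have hm := 𝒳.continuous_invol.measurable
  have h := 𝒳.ae_compLam2_source hlam ν hP
  rw [𝒳.compLam2_eq_map hlam] at h
  exact ae_of_ae_map hm.aemeasurable h

/-- The sets of `(g, x)` with `g⁻¹` in a given compact set have finite `λ₂`-mass for every `x`,
because `λ^u` is finite on compact sets. -/
theorem sigmaFinite_compLam2 [T1Space X] (hlam : 𝒢.IsHaarSystem lam) (ν : Measure X)
    [SigmaFinite ν] : SigmaFinite (𝒳.compLam2 lam ν) := by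
  have := hlam.isContinuousSystem.finite_on_compacts
  have hinv : Continuous fun p : 𝒳.SemiDirect => 𝒢.inv p.1.1 :=
    𝒢.continuous_inv.comp (continuous_fst.comp continuous_subtype_val)
  refine sigmaFinite_bind_of_cover 𝒳.measurable_source (𝒳.measurable_lam2 hlam) 𝒳.ae_lam2_source
    (B := fun n => (fun p : 𝒳.SemiDirect => 𝒢.inv p.1.1) ⁻¹' compactCovering G n) (fun n =>
    hinv.measurable (isCompact_compactCovering G n).measurableSet) ?_ fun x n => ?_
  · rw [← preimage_iUnion, iUnion_compactCovering, preimage_univ]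
  · rw [lam2, Measure.map_apply (𝒳.continuous_toSourceFiber x).measurable
      (hinv.measurable (isCompact_compactCovering G n).measurableSet)]
    refine IsCompact.measure_lt_top ?_
    have : 𝒳.toSourceFiber x ⁻¹' ((fun p : 𝒳.SemiDirect => 𝒢.inv p.1.1) ⁻¹' compactCovering G n) =
        Subtype.val ⁻¹' compactCovering G n := by
      ext g
      simp [toSourceFiber, 𝒢.inv_inv]
    rw [this]
    exact (isClosed_singleton.preimage 𝒢.continuous_r).isClosedEmbedding_subtypeVal.isCompact_preimage
      (isCompact_compactCovering G n)

theorem sigmaFinite_compLam1 [T1Space X] (hlam : 𝒢.IsHaarSystem lam) (ν : Measure X)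
    [SigmaFinite ν] : SigmaFinite (𝒳.compLam1 lam ν) := by
  have := 𝒳.sigmaFinite_compLam2 hlam ν
  rw [𝒳.compLam1_eq_map hlam]
  exact (MeasurableEquiv.ofInvolutive 𝒳.invol 𝒳.invol_invol
    𝒳.continuous_invol.measurable).sigmaFinite_map

theorem IsQuasiInvariant.exists_isDeltaMeasure [T1Space X] {𝒳 : LeftGSpace 𝒢 X}
    (hlam : 𝒢.IsHaarSystem lam) {ν : Measure X} [SigmaFinite ν] (hν : 𝒳.IsQuasiInvariant lam ν) :
    ∃ Δ, 𝒳.IsDeltaMeasure lam Δ ν := by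
  have := 𝒳.sigmaFinite_compLam1 hlam ν
  have := 𝒳.sigmaFinite_compLam2 hlam ν
  obtain ⟨Δ, hm, h0, h⟩ := exists_density_of_absolutelyContinuous hν.1 hν.2
  exact ⟨Δ, hm, h0, h⟩

end

end LeftGSpace

/-! ### Normalising the system `ρ`, and σ-finiteness of continuous systems. -/

/-- Each `ρ y` is σ-finite, but not uniformly in `y`. A positive `ν`-integrable function is `ρ
y`-integrable for almost every `y`; setting `ρ y` to zero at the other `y` yields one weight for all
fibres, as the kernel argument in `measurable_fiberMeasure` requires. -/
theorem IsBorelSystem.exists_truncation {X Y : Type*} [MeasurableSpace X] [MeasurableSpace Y]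
    {π : X → Y} (hπ : Measurable π) {ν : Measure X} [SigmaFinite ν] {μ : Measure Y}
    {ρ : (y : Y) → Measure (Fiber π y)} (hρ : IsBorelSystem π ρ)
    (hν : IsIntegralOfSystem π ν ρ μ) :
    ∃ ρ' : (y : Y) → Measure (Fiber π y), IsBorelSystem π ρ' ∧ (∀ᵐ y ∂μ, ρ' y = ρ y) ∧
      ∃ w : X → NNReal, Measurable w ∧ (∀ x, 0 < w x) ∧ ∀ y, ∫⁻ x, w x.1 ∂(ρ' y) ≤ 1 := by
  classical
  obtain ⟨w, hw0, hwm, hw⟩ := exists_pos_lintegral_lt_of_sigmaFinite ν one_ne_zero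
  let W : Y → ENNReal := fun y => ∫⁻ x, w x.1 ∂(ρ y)
  have hW : Measurable W := hρ.measurable_lintegral _ hwm.coe_nnreal_ennreal
  let ρ' : (y : Y) → Measure (Fiber π y) := fun y => if W y < ⊤ then ρ y else 0
  have hpos : ∀ y, (ρ' y = ρ y ∧ W y < ⊤) ∨ (ρ' y = 0 ∧ ¬ W y < ⊤) := fun y => by
    by_cases h : W y < ⊤ <;> simp only [ρ', h, if_true, if_false, not_true, not_false_iff,
      and_true, and_false, or_true, or_false]
  -- Dividing by `1 + W (π x)`, constant on fibres, brings the integral to `W / (1 + W) ≤ 1`. Where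
  -- `W = ⊤`, `toNNReal` is `0`, so the weight stays positive, and `ρ'` vanishes there.
  refine ⟨ρ', ⟨fun y => ?_, fun f hf => ?_⟩, ?_,
    fun x => w x * (1 + (W (π x)).toNNReal)⁻¹, ?_, fun x => ?_, fun y => ?_⟩
  · have := hρ.sigmaFinite y
    rcases hpos y with h | h <;> rw [h.1] <;> infer_instance
  · have : (fun y => ∫⁻ x, f x.1 ∂(ρ' y)) =
        {y | W y < ⊤}.indicator fun y => ∫⁻ x, f x.1 ∂(ρ y) := by
      funext y
      rcases hpos y with h | h
      · rw [h.1, indicator_of_mem (show y ∈ {y | W y < ⊤} from h.2)]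
      · rw [h.1, indicator_of_notMem (show y ∉ {y | W y < ⊤} from h.2), lintegral_zero_measure]
    rw [this]
    exact (hρ.measurable_lintegral f hf).indicator (hW measurableSet_Iio)
  · have hWi : ∫⁻ y, W y ∂μ ≠ ⊤ := by
      rw [← hν _ hwm.coe_nnreal_ennreal]
      exact (hw.trans ENNReal.one_lt_top).ne
    filter_upwards [ae_lt_top hW hWi] with y hy
    exact if_pos hy
  · exact hwm.mul ((measurable_const.add (hW.comp hπ).ennreal_toNNReal).inv)
  · exact mul_pos (hw0 x) (by positivity)
  · rcases hpos y with h | h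
    · rw [h.1]
      have hc : ∀ x : Fiber π y, ((w x.1 * (1 + (W (π x.1)).toNNReal)⁻¹ : NNReal) : ENNReal) =
          w x.1 * ((1 + (W y).toNNReal)⁻¹ : NNReal) := fun x => by rw [x.2, ENNReal.coe_mul]
      simp_rw [hc]
      rw [lintegral_mul_const (f := fun x : Fiber π y => (w x.1 : ENNReal)) _
        (hwm.coe_nnreal_ennreal.comp measurable_subtype_coe)]
      change W y * _ ≤ 1
      conv_lhs => rw [← ENNReal.coe_toNNReal h.2.ne]
      rw [ENNReal.toNNReal_coe, ← ENNReal.coe_mul, ← ENNReal.coe_one, ENNReal.coe_le_coe,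
        ← div_eq_mul_inv]
      exact div_le_one_of_le₀ (by simp) (by positivity)
    · rw [h.1, lintegral_zero_measure]
      exact zero_le

instance Fiber.secondCountableTopology {Z W : Type*} [TopologicalSpace Z]
    [SecondCountableTopology Z] (p : Z → W) (w : W) : SecondCountableTopology (Fiber p w) :=
  IsEmbedding.subtypeVal.secondCountableTopology

theorem IsContinuousSystem.sigmaFinite {Z W : Type*} [TopologicalSpace Z]
    [LocallyCompactSpace Z] [SecondCountableTopology Z] [MeasurableSpace Z]
    [BorelSpace Z] [TopologicalSpace W] [T1Space W] {p : Z → W} (hp : Continuous p)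
    {α : (w : W) → Measure (Fiber p w)} (hα : IsContinuousSystem p α) (w : W) :
    SigmaFinite (α w) := by
  have := hα.finite_on_compacts w
  have : LocallyCompactSpace (Fiber p w) :=
    (isClosed_singleton.preimage hp).isClosedEmbedding_subtypeVal.locallyCompactSpace
  infer_instance

/-! ### Disintegration of `ν ∘ λ₂` along `id × π`. -/

namespace IsEquivariant

variable {G U X Y : Type*} [TopologicalSpace G] [TopologicalSpace U]
    [TopologicalSpace X] [TopologicalSpace Y] {𝒢 : TopGroupoid G U}
    {𝒳 : LeftGSpace 𝒢 X} {𝒴 : LeftGSpace 𝒢 Y} {π : X → Y}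

/-- For `p = (g, y)` and `x` in the fibre of `π` above `y`, the element `(g, x)` of `G ⋉ X`. -/
def pairFiber (hπ : IsEquivariant 𝒳 𝒴 π) (p : 𝒴.SemiDirect) (x : Fiber π p.1.2) :
    𝒳.SemiDirect :=
  ⟨(p.1.1, x.1), p.2.trans ((congrArg 𝒴.moment x.2).symm.trans (hπ.moment_map x.1))⟩

theorem continuous_pairFiber (hπ : IsEquivariant 𝒳 𝒴 π) (p : 𝒴.SemiDirect) :
    Continuous (hπ.pairFiber p) :=
  (continuous_const.prodMk continuous_subtype_val).subtype_mk _

theorem continuous_idProd (hπ : IsEquivariant 𝒳 𝒴 π) (hπc : Continuous π) :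
    Continuous hπ.idProd :=
  ((continuous_fst.comp continuous_subtype_val).prodMk
    (hπc.comp (continuous_snd.comp continuous_subtype_val))).subtype_mk _

/-- For `g` with range `moment y` and `x` in the fibre of `π` above `y`, the element `(g⁻¹, x)`
of `G ⋉ X`. -/
def sourcePair (hπ : IsEquivariant 𝒳 𝒴 π) {y : Y} (x : Fiber π y)
    (g : Fiber 𝒢.r (𝒴.moment y)) : 𝒳.SemiDirect :=
  hπ.pairFiber (𝒴.toSourceFiber y g) x

theorem continuous_sourcePair (hπ : IsEquivariant 𝒳 𝒴 π) (y : Y) :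
    Continuous fun q : Fiber π y × Fiber 𝒢.r (𝒴.moment y) => hπ.sourcePair q.1 q.2 :=
  ((𝒢.continuous_inv.comp (continuous_subtype_val.comp continuous_snd)).prodMk
    (continuous_subtype_val.comp continuous_fst)).subtype_mk _

theorem idProd_pairFiber (hπ : IsEquivariant 𝒳 𝒴 π) (p : 𝒴.SemiDirect) (x : Fiber π p.1.2) :
    hπ.idProd (hπ.pairFiber p x) = p :=
  Subtype.ext (Prod.ext rfl x.2)

theorem idProd_invol (hπ : IsEquivariant 𝒳 𝒴 π) (p : 𝒳.SemiDirect) :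
    hπ.idProd (𝒳.invol p) = 𝒴.invol (hπ.idProd p) :=
  Subtype.ext (Prod.ext rfl (hπ.map_act _ _ _))

theorem continuous_actFiber (hπ : IsEquivariant 𝒳 𝒴 π) (p : 𝒴.SemiDirect) :
    Continuous (hπ.actFiber p) :=
  (𝒳.continuous_act.comp (hπ.continuous_pairFiber p)).subtype_mk _

variable [MeasurableSpace X]

theorem lam2_eq_map [MeasurableSpace G] (hπ : IsEquivariant 𝒳 𝒴 π)
    (lam : (u : U) → Measure (Fiber 𝒢.r u)) {y : Y} (x : Fiber π y) :
    𝒳.lam2 lam x.1 =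
      (lam (𝒴.moment y)).map (hπ.sourcePair x) := by
  obtain ⟨x, rfl⟩ := x
  -- The fibres over `𝒴.moment (π x)` and `𝒳.moment x` are different types; generalising the unit
  -- lets the equality be substituted.
  have h : ∀ u (e : u = 𝒳.moment x), 𝒳.lam2 lam x =
      (lam u).map fun g => ⟨(𝒢.inv g.1, x), (𝒢.s_inv g.1).trans (g.2.trans e)⟩ := by
    rintro _ rfl; rfl
  exact h _ (hπ.moment_map x)

variable [BorelSpace X] [MeasurableSpace G] [BorelSpace G] [SecondCountableTopology X]

theorem map_idProd_lam2 [MeasurableSpace Y] [BorelSpace Y] [SecondCountableTopology Y]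
    (hπ : IsEquivariant 𝒳 𝒴 π) (hπc : Continuous π) (lam : (u : U) → Measure (Fiber 𝒢.r u))
    (x : X) : (𝒳.lam2 lam x).map hπ.idProd = 𝒴.lam2 lam (π x) := by
  have hc : Continuous (hπ.sourcePair (⟨x, rfl⟩ : Fiber π (π x))) :=
    (hπ.continuous_sourcePair (π x)).comp (continuous_const.prodMk continuous_id)
  rw [hπ.lam2_eq_map lam (⟨x, rfl⟩ : Fiber π (π x)),
    Measure.map_map (hπ.continuous_idProd hπc).measurable hc.measurable]
  rfl

/-- For `p = (g, y)`, the image of `ρ_y` under `x ↦ (g, x)`. -/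
noncomputable def fiberMeasure (hπ : IsEquivariant 𝒳 𝒴 π) (ρ : (y : Y) → Measure (Fiber π y))
    (p : 𝒴.SemiDirect) : Measure 𝒳.SemiDirect :=
  (ρ p.1.2).map (hπ.pairFiber p)

theorem ae_fiberMeasure_idProd [MeasurableSpace Y] [BorelSpace Y] [SecondCountableTopology Y]
    [T1Space G] [T1Space Y] (hπ : IsEquivariant 𝒳 𝒴 π) (hπc : Continuous π)
    (ρ : (y : Y) → Measure (Fiber π y)) (p : 𝒴.SemiDirect) :
    ∀ᵐ z ∂(hπ.fiberMeasure ρ p), hπ.idProd z = p :=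
  (ae_map_iff (hπ.continuous_pairFiber p).measurable.aemeasurable
    ((hπ.continuous_idProd hπc).measurable (measurableSet_singleton p))).2
    (ae_of_all _ (hπ.idProd_pairFiber p))

/-- Both sides push `ρ_y` forward along `x ↦ (g⁻¹, g x)`. -/
theorem map_invol_fiberMeasure (hπ : IsEquivariant 𝒳 𝒴 π)
    (ρ : (y : Y) → Measure (Fiber π y)) (p : 𝒴.SemiDirect) :
    (hπ.fiberMeasure ρ p).map 𝒳.invol = (hπ.translate ρ p).map (hπ.pairFiber (𝒴.invol p)) := by
  rw [fiberMeasure, translate, Measure.map_map 𝒳.continuous_invol.measurable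
    (hπ.continuous_pairFiber p).measurable]
  exact (Measure.map_map (hπ.continuous_pairFiber (𝒴.invol p)).measurable
    (hπ.continuous_actFiber p).measurable).symm

/-- Projecting to `X` leaves the inclusion of a closed fibre, a measurable embedding, along which
`comap` recovers the measure. -/
theorem map_pairFiber_injective [T1Space Y] (hπ : IsEquivariant 𝒳 𝒴 π) (hπc : Continuous π)
    (p : 𝒴.SemiDirect) : Function.Injective (Measure.map (hπ.pairFiber p)) := by
  intro m m' h
  have he : MeasurableEmbedding (Subtype.val : Fiber π p.1.2 → X) :=
    MeasurableEmbedding.subtype_coe (isClosed_singleton.preimage hπc).measurableSet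
  have h2 := congrArg (Measure.map fun z : 𝒳.SemiDirect => z.1.2) h
  beta_reduce at h2
  rw [Measure.map_map 𝒳.measurable_source (hπ.continuous_pairFiber p).measurable,
    Measure.map_map 𝒳.measurable_source (hπ.continuous_pairFiber p).measurable] at h2
  have h3 := congrArg (Measure.comap (Subtype.val : Fiber π p.1.2 → X)) h2
  change Measure.comap Subtype.val (Measure.map Subtype.val m) =
    Measure.comap Subtype.val (Measure.map Subtype.val m') at h3
  rwa [he.comap_map, he.comap_map] at h3

/-- Moves the relation from the varying fibres of `π` to the single space `G ⋉ X`, in the form used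
by `map_bind_eq_withDensity_iff`. -/
theorem translateEq_iff [T1Space Y] (hπ : IsEquivariant 𝒳 𝒴 π) (hπc : Continuous π)
    (ρ : (y : Y) → Measure (Fiber π y)) {δ : 𝒳.SemiDirect → ℝ} (hδ : Measurable δ)
    (p : 𝒴.SemiDirect) : hπ.TranslateEq ρ δ p ↔
      (hπ.fiberMeasure ρ p).map 𝒳.invol =
        (hπ.fiberMeasure ρ (𝒴.invol p)).withDensity fun z => ENNReal.ofReal (δ z) := by
  have h := map_withDensity_comp (hπ.continuous_pairFiber (𝒴.invol p)).measurable
    (ρ (𝒴.rng p)) hδ.ennreal_ofReal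
  rw [hπ.map_invol_fiberMeasure, fiberMeasure]
  refine Iff.trans ?_ (Eq.congr_right h)
  exact (hπ.map_pairFiber_injective hπc (𝒴.invol p)).eq_iff.symm

/-- The set being measured varies with `g` as well as `y`, so joint measurability is needed. The
weighted measures `w ρ_y` form a finite kernel, for which it holds; the factor `w⁻¹` in the
integrand undoes the weight. -/
theorem measurable_fiberMeasure [MeasurableSpace Y] [BorelSpace Y] [T2Space U]
    (hπ : IsEquivariant 𝒳 𝒴 π) {ρ : (y : Y) → Measure (Fiber π y)} (hρ : IsBorelSystem π ρ)
    {w : X → NNReal} (hw : Measurable w) (hw0 : ∀ x, 0 < w x)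
    (hρw : ∀ y, ∫⁻ x, w x.1 ∂(ρ y) ≤ 1) : Measurable (hπ.fiberMeasure ρ) := by
  have hw' : Measurable fun x => (w x : ENNReal) := hw.coe_nnreal_ennreal
  have hR : ∀ y (f : X → ENNReal), Measurable f →
      ∫⁻ x, f x ∂(((ρ y).map Subtype.val).withDensity fun x => w x) =
        ∫⁻ x, w x.1 * f x.1 ∂(ρ y) := fun y f hf => by
    rw [lintegral_withDensity_eq_lintegral_mul _ hw' hf,
      lintegral_map (hw'.mul hf) measurable_subtype_coe]
    rfl
  let R : ProbabilityTheory.Kernel Y X :=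
    ⟨fun y => ((ρ y).map Subtype.val).withDensity fun x => w x, by
      refine Measure.measurable_of_measurable_coe _ fun B hB => ?_
      simp_rw [← lintegral_indicator_one hB]
      simp_rw [hR _ _ (measurable_one.indicator hB)]
      exact hρ.measurable_lintegral _ (hw'.mul (measurable_one.indicator hB))⟩
  have : ProbabilityTheory.IsFiniteKernel R := ⟨1, ENNReal.one_lt_top, fun y => by
    rw [← setLIntegral_one, setLIntegral_univ]
    refine (hR y _ measurable_one).trans_le ?_
    simpa using hρw y⟩
  have hemb : MeasurableEmbedding (Subtype.val : 𝒳.SemiDirect → G × X) :=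
    MeasurableEmbedding.subtype_coe (isClosed_eq (𝒢.continuous_s.comp continuous_fst)
      (𝒳.continuous_moment.comp continuous_snd)).measurableSet
  refine Measure.measurable_of_measurable_coe _ fun B hB => ?_
  -- Kernel integrals need an integrand on a full product; `G ⋉ X` is closed in `G × X`, so the
  -- image of `B` is Borel there.
  let F : G × X → ENNReal := (Subtype.val '' B).indicator 1
  have hF : Measurable F := measurable_one.indicator (hemb.measurableSet_image.2 hB)
  have key : ∀ p, hπ.fiberMeasure ρ p B = ∫⁻ x, F (p.1.1, x) * (w x : ENNReal)⁻¹ ∂(R p.1.2) := by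
    intro p
    refine Eq.trans ?_ (hR p.1.2 _ ((hF.comp measurable_prodMk_left).mul hw'.inv)).symm
    rw [fiberMeasure, Measure.map_apply (hπ.continuous_pairFiber p).measurable hB,
      ← lintegral_indicator_one ((hπ.continuous_pairFiber p).measurable hB)]
    refine lintegral_congr fun x => ?_
    have hx0 : (w x.1 : ENNReal) ≠ 0 := by simpa using (hw0 x.1).ne'
    change _ = (w x.1 : ENNReal) * (F (p.1.1, x.1) * (w x.1 : ENNReal)⁻¹)
    rw [mul_comm, mul_assoc, ENNReal.inv_mul_cancel hx0 ENNReal.coe_ne_top,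
      mul_one]
    by_cases hx : hπ.pairFiber p x ∈ B
    · rw [indicator_of_mem (show x ∈ hπ.pairFiber p ⁻¹' B from hx)]
      exact (indicator_of_mem (show (p.1.1, x.1) ∈ Subtype.val '' B from ⟨_, hx, rfl⟩) 1).symm
    · rw [indicator_of_notMem (show x ∉ hπ.pairFiber p ⁻¹' B from hx)]
      refine (indicator_of_notMem (fun h => hx ?_) _).symm
      obtain ⟨z, hz, hzx⟩ := h
      exact (Subtype.ext hzx : z = hπ.pairFiber p x) ▸ hz
  simp_rw [key]
  have hm : Measurable fun q : (G × Y) × X => F (q.1.1, q.2) * (w q.2 : ENNReal)⁻¹ :=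
    (hF.comp ((measurable_fst.comp measurable_fst).prodMk measurable_snd)).mul
      (hw'.comp measurable_snd).inv
  exact (Measurable.lintegral_kernel_prod_right' (κ := R.comap Prod.snd measurable_snd) hm).comp
    measurable_subtype_coe

variable [MeasurableSpace Y] [BorelSpace Y] [SecondCountableTopology Y]
  [LocallyCompactSpace G] [T2Space G] [SecondCountableTopology G] [T2Space U]
  {lam : (u : U) → Measure (Fiber 𝒢.r u)}

/-- Over a fixed `y`, both sides integrate the indicator of `B` at `(g⁻¹, x)` against `λ^{r(y)}` and
`ρ_y`, in opposite orders; both measures are σ-finite, so Tonelli applies. -/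
theorem compLam2_eq_bind (hlam : 𝒢.IsHaarSystem lam) (hπ : IsEquivariant 𝒳 𝒴 π)
    {ν : Measure X} {μ : Measure Y} {ρ : (y : Y) → Measure (Fiber π y)}
    (hρ : IsBorelSystem π ρ) (hν : IsIntegralOfSystem π ν ρ μ)
    (hm : Measurable (hπ.fiberMeasure ρ)) :
    𝒳.compLam2 lam ν = (𝒴.compLam2 lam μ).bind (hπ.fiberMeasure ρ) := by
  ext B hB
  have hmB : Measurable fun p => hπ.fiberMeasure ρ p B := (Measure.measurable_coe hB).comp hm
  have hlB : Measurable fun x => 𝒳.lam2 lam x B :=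
    (Measure.measurable_coe hB).comp (𝒳.measurable_lam2 hlam)
  rw [Measure.bind_apply hB hm.aemeasurable, 𝒴.lintegral_compLam2 hlam μ hmB,
    LeftGSpace.compLam2, Measure.bind_apply hB (𝒳.measurable_lam2 hlam).aemeasurable, hν _ hlB]
  refine lintegral_congr fun y => ?_
  have := hρ.sigmaFinite y
  have := hlam.isContinuousSystem.sigmaFinite 𝒢.continuous_r (𝒴.moment y)
  have hc := hπ.continuous_sourcePair y
  have h1 : ∀ x : Fiber π y, 𝒳.lam2 lam x.1 B = ∫⁻ g, B.indicator 1
      (hπ.sourcePair x g) ∂(lam (𝒴.moment y)) := fun x => by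
    rw [← lintegral_indicator_one hB, hπ.lam2_eq_map lam x,
      lintegral_map (measurable_one.indicator hB)
        (f := B.indicator 1) (g := hπ.sourcePair x)
        (hc.comp (continuous_const.prodMk continuous_id)).measurable]
  have h2 : ∀ g, hπ.fiberMeasure ρ (𝒴.toSourceFiber y g) B = ∫⁻ x, B.indicator 1
      (hπ.sourcePair x g) ∂(ρ y) := fun g => by
    rw [← lintegral_indicator_one hB, fiberMeasure,
      lintegral_map (measurable_one.indicator hB) (hπ.continuous_pairFiber _).measurable]
    rfl
  simp_rw [h1, h2]
  exact lintegral_lintegral_swap ((measurable_one.indicator hB).comp hc.measurable).aemeasurable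

/-! ### The cocycle equivalence and quasi-invariance of `μ`. -/

theorem compLam1_eq_withDensity_iff [T2Space X] [T2Space Y] (hlam : 𝒢.IsHaarSystem lam)
    (hπ : IsEquivariant 𝒳 𝒴 π) (hπc : Continuous π) {ν : Measure X} [SigmaFinite ν]
    {μ : Measure Y} [SigmaFinite μ] {ρ : (y : Y) → Measure (Fiber π y)}
    (hρ : IsBorelSystem π ρ) (hν : IsIntegralOfSystem π ν ρ μ)
    {ΔY : 𝒴.SemiDirect → ℝ} (hΔY : 𝒴.IsDeltaMeasure lam ΔY μ) {δ : 𝒳.SemiDirect → ℝ}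
    (hδ : Measurable δ) (hδ0 : ∀ p, 0 < δ p) :
    𝒳.compLam1 lam ν = (𝒳.compLam2 lam ν).withDensity
        (fun p => ENNReal.ofReal (δ p * ΔY (hπ.idProd p))) ↔
      ∀ᵐ p ∂(𝒴.compLam1 lam μ), hπ.TranslateEq ρ δ p := by
  obtain ⟨ρ', hρ', hρρ', w, hw, hw0, hρw⟩ := hρ.exists_truncation hπc.measurable hν
  have hν' : IsIntegralOfSystem π ν ρ' μ := fun f hf => by
    rw [hν f hf]
    refine lintegral_congr_ae ?_
    filter_upwards [hρρ'] with y hy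
    rw [hy]
  have hm := hπ.measurable_fiberMeasure hρ' hw hw0 hρw
  have hbind := compLam2_eq_bind hlam hπ hρ' hν' hm
  have hsY := 𝒴.sigmaFinite_compLam1 hlam μ
  have hsX := 𝒳.sigmaFinite_compLam1 hlam ν
  rw [𝒴.compLam1_eq_map hlam] at hsY
  rw [𝒳.compLam1_eq_map hlam, hbind] at hsX
  have hM := hΔY.eq_withDensity
  rw [𝒴.compLam1_eq_map hlam] at hM
  have hiff := map_bind_eq_withDensity_iff (hπ.continuous_idProd hπc).measurable
    𝒳.continuous_invol.measurable 𝒴.continuous_invol.measurable 𝒴.invol_invol hπ.idProd_invol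
    hm (hπ.ae_fiberMeasure_idProd hπc ρ') hΔY.measurable hΔY.pos hM hδ hδ0
  rw [← hbind, ← 𝒳.compLam1_eq_map hlam, ← 𝒴.compLam1_eq_map hlam] at hiff
  rw [hiff]
  -- Returning from `ρ'` to `ρ` at `p` requires agreement at both the range and the source of `p`.
  -- The range is controlled by `μ ∘ λ₁` directly, the source by `μ ∘ λ₂` and hence by
  -- quasi-invariance.
  have h1 := 𝒴.ae_compLam1_rng hlam μ hρρ'
  have h2 := hΔY.isQuasiInvariant.1.ae_le (𝒴.ae_compLam2_source hlam μ hρρ')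
  refine Filter.eventually_congr ?_
  filter_upwards [h1, h2] with p hp1 hp2
  rw [← hπ.translateEq_iff hπc ρ' hδ p, TranslateEq, TranslateEq, translate, translate, hp1, hp2]

/-- Since `id × π` sends `λ₂(·)(x)` to `λ₂(·)(π x)`, both conditions say that `{y | λ₂(B)(y) ≠ 0}`
is null, for `μ` or, pulled back by `π`, for `ν`. -/
theorem compLam2_preimage_eq_zero_iff (hlam : 𝒢.IsHaarSystem lam) (hπ : IsEquivariant 𝒳 𝒴 π)
    (hπc : Continuous π) {ν : Measure X} {μ : Measure Y}
    (h : ∀ B : Set Y, MeasurableSet B → (μ B = 0 ↔ ν (π ⁻¹' B) = 0)) {B : Set 𝒴.SemiDirect}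
    (hB : MeasurableSet B) :
    𝒴.compLam2 lam μ B = 0 ↔ 𝒳.compLam2 lam ν (hπ.idProd ⁻¹' B) = 0 := by
  have hq := (hπ.continuous_idProd hπc).measurable
  have hmY : Measurable fun y => 𝒴.lam2 lam y B :=
    (Measure.measurable_coe hB).comp (𝒴.measurable_lam2 hlam)
  have hX : ∀ x, 𝒳.lam2 lam x (hπ.idProd ⁻¹' B) = 𝒴.lam2 lam (π x) B := fun x => by
    rw [← hπ.map_idProd_lam2 hπc lam x, Measure.map_apply hq hB]
  rw [LeftGSpace.compLam2, LeftGSpace.compLam2,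
    Measure.bind_apply hB (𝒴.measurable_lam2 hlam).aemeasurable,
    Measure.bind_apply (hq hB) (𝒳.measurable_lam2 hlam).aemeasurable]
  simp_rw [hX]
  rw [lintegral_eq_zero_iff hmY,
    lintegral_eq_zero_iff (f := fun x => 𝒴.lam2 lam (π x) B) (hmY.comp hπc.measurable)]
  exact h _ (hmY (measurableSet_singleton 0).compl)

theorem compLam1_preimage_eq_zero_iff (hlam : 𝒢.IsHaarSystem lam) (hπ : IsEquivariant 𝒳 𝒴 π)
    (hπc : Continuous π) {ν : Measure X} {μ : Measure Y}
    (h : ∀ B : Set Y, MeasurableSet B → (μ B = 0 ↔ ν (π ⁻¹' B) = 0)) {B : Set 𝒴.SemiDirect}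
    (hB : MeasurableSet B) :
    𝒴.compLam1 lam μ B = 0 ↔ 𝒳.compLam1 lam ν (hπ.idProd ⁻¹' B) = 0 := by
  have hq := (hπ.continuous_idProd hπc).measurable
  have hJX := 𝒳.continuous_invol.measurable
  have hJY := 𝒴.continuous_invol.measurable
  rw [𝒴.compLam1_eq_map hlam, 𝒳.compLam1_eq_map hlam, Measure.map_apply hJY hB,
    Measure.map_apply hJX (hq hB), hπ.compLam2_preimage_eq_zero_iff hlam hπc h (hJY hB)]
  have : 𝒳.invol ⁻¹' (hπ.idProd ⁻¹' B) = hπ.idProd ⁻¹' (𝒴.invol ⁻¹' B) := by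
    ext z
    simp only [mem_preimage, hπ.idProd_invol]
  rw [this]

theorem isQuasiInvariant_of_pseudoImage (hlam : 𝒢.IsHaarSystem lam) (hπ : IsEquivariant 𝒳 𝒴 π)
    (hπc : Continuous π) {ν : Measure X} {μ : Measure Y}
    (h : ∀ B : Set Y, MeasurableSet B → (μ B = 0 ↔ ν (π ⁻¹' B) = 0))
    (hν : 𝒳.IsQuasiInvariant lam ν) : 𝒴.IsQuasiInvariant lam μ :=
  ⟨Measure.AbsolutelyContinuous.mk fun _ hB h0 =>
      (compLam1_preimage_eq_zero_iff hlam hπ hπc h hB).2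
        (hν.1 ((compLam2_preimage_eq_zero_iff hlam hπ hπc h hB).1 h0)),
    Measure.AbsolutelyContinuous.mk fun _ hB h0 =>
      (compLam2_preimage_eq_zero_iff hlam hπ hπc h hB).2
        (hν.2 ((compLam1_preimage_eq_zero_iff hlam hπ hπc h hB).1 h0))⟩

end IsEquivariant

/-! ### Conclusion. -/

theorem IsEquivariant.TranslateEq.absolutelyContinuous {G U X Y : Type*} [TopologicalSpace G]
    [TopologicalSpace U] [TopologicalSpace X] [TopologicalSpace Y] {𝒢 : TopGroupoid G U}
    {𝒳 : LeftGSpace 𝒢 X} {𝒴 : LeftGSpace 𝒢 Y} {π : X → Y} [MeasurableSpace G] [BorelSpace G]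
    [MeasurableSpace X] [BorelSpace X] [SecondCountableTopology X]
    {hπ : IsEquivariant 𝒳 𝒴 π} {ρ : (y : Y) → Measure (Fiber π y)} {δ : 𝒳.SemiDirect → ℝ}
    (hδ : Measurable δ) (hδ0 : ∀ p, 0 < δ p) {p : 𝒴.SemiDirect} (h : hπ.TranslateEq ρ δ p) :
    hπ.translate ρ p ≪ ρ (𝒴.rng p) ∧ ρ (𝒴.rng p) ≪ hπ.translate ρ p := by
  rw [h]
  exact ⟨withDensity_absolutelyContinuous _ _, absolutelyContinuous_withDensity_of_pos
    (hδ.comp (hπ.continuous_pairFiber (𝒴.invol p)).measurable) fun x => hδ0 (hπ.invPair p x)⟩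

theorem proposition3p1
    {G U X Y : Type*}
    [TopologicalSpace G] [LocallyCompactSpace G] [T2Space G] [SecondCountableTopology G]
    [TopologicalSpace U] [LocallyCompactSpace U] [T2Space U] [SecondCountableTopology U]
    [TopologicalSpace X] [LocallyCompactSpace X] [T2Space X] [SecondCountableTopology X]
    [TopologicalSpace Y] [LocallyCompactSpace Y] [T2Space Y] [SecondCountableTopology Y]
    [MeasurableSpace G] [BorelSpace G] [MeasurableSpace X] [BorelSpace X]
    [MeasurableSpace Y] [BorelSpace Y]
    (𝒢 : TopGroupoid G U) (lam : (u : U) → Measure (Fiber 𝒢.r u)) (hlam : 𝒢.IsHaarSystem lam)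
    (𝒳 : LeftGSpace 𝒢 X) (𝒴 : LeftGSpace 𝒢 Y)
    (π : X → Y) (hπc : Continuous π) (hπs : Function.Surjective π) (hπ : IsEquivariant 𝒳 𝒴 π)
    (ν : Measure X) [SigmaFinite ν] (μ : Measure Y) [SigmaFinite μ]
    (ρ : (y : Y) → Measure (Fiber π y)) :
    -- (i)
    (IsDisintegration π ν ρ μ → 𝒳.IsQuasiInvariant lam ν →
      𝒴.IsQuasiInvariant lam μ ∧
      (∀ᵐ p ∂(𝒴.compLam1 lam μ),
        hπ.translate ρ p ≪ ρ (𝒴.rng p) ∧ ρ (𝒴.rng p) ≪ hπ.translate ρ p) ∧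
      ∀ ΔX : 𝒳.SemiDirect → ℝ, 𝒳.IsDeltaMeasure lam ΔX ν →
        ∃ (ΔY : 𝒴.SemiDirect → ℝ) (δ : 𝒳.SemiDirect → ℝ),
          𝒴.IsDeltaMeasure lam ΔY μ ∧
          Measurable δ ∧ (∀ p, 0 < δ p) ∧
          (∀ᵐ p ∂(𝒴.compLam1 lam μ), hπ.TranslateEq ρ δ p) ∧
          (∀ᵐ p ∂(𝒳.compLam1 lam ν), ΔX p = δ p * ΔY (hπ.idProd p))) ∧
    -- (ii); here `μ` need not be a pseudo-image of `ν`
    (IsBorelSystem π ρ → IsIntegralOfSystem π ν ρ μ →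
      ∀ (ΔY : 𝒴.SemiDirect → ℝ) (δ : 𝒳.SemiDirect → ℝ),
        𝒴.IsDeltaMeasure lam ΔY μ →
        Measurable δ → (∀ p, 0 < δ p) →
        (∀ᵐ p ∂(𝒴.compLam1 lam μ), hπ.TranslateEq ρ δ p) →
        ∀ ΔX : 𝒳.SemiDirect → ℝ, Measurable ΔX → (∀ p, 0 < ΔX p) →
          (∀ᵐ p ∂(𝒳.compLam1 lam ν), ΔX p = δ p * ΔY (hπ.idProd p)) →
          𝒳.IsDeltaMeasure lam ΔX ν) := by
  have main : IsDisintegration π ν ρ μ → 𝒴.IsQuasiInvariant lam μ →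
      ∀ ΔX : 𝒳.SemiDirect → ℝ, 𝒳.IsDeltaMeasure lam ΔX ν →
        ∃ (ΔY : 𝒴.SemiDirect → ℝ) (δ : 𝒳.SemiDirect → ℝ),
          𝒴.IsDeltaMeasure lam ΔY μ ∧ Measurable δ ∧ (∀ p, 0 < δ p) ∧
          (∀ᵐ p ∂(𝒴.compLam1 lam μ), hπ.TranslateEq ρ δ p) ∧
          (∀ᵐ p ∂(𝒳.compLam1 lam ν), ΔX p = δ p * ΔY (hπ.idProd p)) := by
    intro hd hμ ΔX hΔX
    obtain ⟨ΔY, hΔY⟩ := hμ.exists_isDeltaMeasure hlam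
    have heq : ∀ p, ΔX p = ΔX p / ΔY (hπ.idProd p) * ΔY (hπ.idProd p) := fun p =>
      (div_mul_cancel₀ _ (hΔY.pos _).ne').symm
    have hδ : Measurable fun p => ΔX p / ΔY (hπ.idProd p) :=
      hΔX.measurable.div (hΔY.measurable.comp (hπ.continuous_idProd hπc).measurable)
    have hδ0 : ∀ p, 0 < ΔX p / ΔY (hπ.idProd p) := fun p => div_pos (hΔX.pos p) (hΔY.pos _)
    -- With `δ` taken as the quotient, the factorisation of `ΔX` holds everywhere, and only the
    -- translation relation remains.
    refine ⟨ΔY, fun p => ΔX p / ΔY (hπ.idProd p), hΔY, hδ, hδ0, ?_, ae_of_all _ heq⟩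
    rw [← IsEquivariant.compLam1_eq_withDensity_iff hlam hπ hπc hd.isBorelSystem hd.isIntegral
      hΔY hδ hδ0]
    simp_rw [← heq]
    exact hΔX.eq_withDensity
  refine ⟨fun hd hν => ?_, fun hρ hν ΔY δ hΔY hδ hδ0 hT ΔX hΔX hΔX0 h => ⟨hΔX, hΔX0, ?_⟩⟩
  · have hμ := IsEquivariant.isQuasiInvariant_of_pseudoImage hlam hπ hπc hd.pseudoImage hν
    refine ⟨hμ, ?_, main hd hμ⟩
    -- Equivalence of `g ρ_y` and `ρ_{g y}` does not involve a modular function; any Radon–Nikodym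
    -- choice provides a positive density `δ` between them.
    obtain ⟨ΔX, hΔX⟩ := hν.exists_isDeltaMeasure hlam
    obtain ⟨ΔY, δ, -, hδ, hδ0, hT, -⟩ := main hd hμ ΔX hΔX
    filter_upwards [hT] with p hp
    exact hp.absolutelyContinuous hδ hδ0
  · have h1 := (IsEquivariant.compLam1_eq_withDensity_iff hlam hπ hπc hρ hν hΔY hδ hδ0).2 hT
    have hm : Measurable fun p => δ p * ΔY (hπ.idProd p) :=
      hδ.mul (hΔY.measurable.comp (hπ.continuous_idProd hπc).measurable)
    -- The factorisation is known `ν ∘ λ₁`-almost everywhere, but changing the density of `ν ∘ λ₂`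
    -- needs it `ν ∘ λ₂`-almost everywhere.
    have hac : 𝒳.compLam2 lam ν ≪ 𝒳.compLam1 lam ν := by
      rw [h1]
      exact absolutelyContinuous_withDensity_of_pos hm fun p => mul_pos (hδ0 p) (hΔY.pos _)
    rw [h1]
    refine withDensity_congr_ae ?_
    filter_upwards [hac.ae_le h] with p hp
    rw [hp]
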